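/- **Theorem 3.2.** Let $E$ be a finite set of bidders and let $\mathcal M=(E,\mathcal I)$ be a matroid; the sets of bidders that can win simultaneously are the independent sets $S\in\mathcal I$. For each $i\in E$ let $F_i$ be a probability distribution on $[0,\infty)$ (the *specified* distribution of bidder $i$), with support $V_i$, such that $z\cdot\Pr_{v\sim F_i}[v\ge z]\to 0$ as $z\to\infty$ (which holds, for example, if $F_i$ has finite mean). Densities are not required and atoms are allowed. *Ironed virtual values.* For $q\in(0,1]$ let $v_i(q)=\sup\{y:\Pr_{v\sim F_i}[v\ge y]\ge q\}$, let $R_i(q)=q\,v_i(q)$ and $R_i(0)=0$, and let $\overline R_i$ be the least concave majorant of $R_i$ on $[0,1]$. The ironed virtual value $\overline\phi_i(z)\in[-\infty,\infty)$ of $z\in V_i$ is the derivative of $\overline R_i$ at $q=\Pr_{v\sim F_i}[v\ge z]$. If the one-sided derivatives differ, it is the left derivative when $F_i([z,y))>0$ for all $y>z$, and the right derivative otherwise. *Myerson's optimal mechanism (MyerOPT).* Given bids $b_i\in V_i$, discard the bidders with $\overline\phi_i(b_i)<0$ and let the set of winners be an independent set of the remaining bidders that maximizes $\sum_{i\in S}\overline\phi_i(b_i)$.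 Ties are broken by any fixed measurable rule that depends only on the vector of ironed virtual values. Each winner $i$ pays her critical bid, the infimum of all $z\in V_i$ such that $i$ still wins when her bid is replaced by $z$ and the other bids are unchanged; losers pay $0$. For $G\subseteq E$, let $\mathrm{MyerOPT}_G$ be the same mechanism run on the bidders in $G$ alone, with the restricted matroid $\mathcal M_{|G}$, the distributions $(F_i)_{i\in G}$, and any tie-breaking rule of the same kind. *Claim.* MyerOPT is Revenue Monotone under Misspecified Bidders: for every partition of $E$ into green bidders $G$ and red bidders $R$ and for all fixed bids $b_R\in\prod_{i\in R}V_i$ of the red bidders, $$\mathbb E_{b_G\sim\prod_{i\in G}F_i}\bigl[\mathrm{Rev}(\mathrm{MyerOPT}(b_G,b_R))\bigr]\;\ge\;\mathbb E_{b_G\sim\prod_{i\in G}F_i}\bigl[\mathrm{Rev}(\mathrm{MyerOPT}_G(b_G))\bigr],$$ where $\mathrm{Rev}$ is the sum of all payments. -/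

import Mathlib

open MeasureTheory Set Filter Topology

noncomputable section

/-! ### Value distributions in quantile space -/

/-- The value `v(q)` at quantile `q ∈ (0, 1]`: the largest price which a bidder with value
distribution `F` accepts with probability at least `q`. -/
def quantileValue (F : Measure ℝ) (q : ℝ) : ℝ :=
  sSup {y : ℝ | q ≤ F.real (Ici y)}

/-- The revenue curve `R(q) = q * v(q)` (so `R(0) = 0`). -/
def revenueCurve (F : Measure ℝ) (q : ℝ) : ℝ :=
  q * quantileValue F q

/-- The concave hull of the revenue curve: its least concave majorant on `[0, 1]`. -/
def ironedRevenueCurve (F : Measure ℝ) (q : ℝ) : ℝ :=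
  sInf {r : ℝ | ∃ g : ℝ → ℝ, ConcaveOn ℝ (Icc 0 1) g ∧
    (∀ t ∈ Icc (0 : ℝ) 1, revenueCurve F t ≤ g t) ∧ r = g q}

open Classical in
/-- The ironed virtual value of the value `z`: the derivative of the ironed revenue curve at the
quantile `q = Pr[v ≥ z]`, in the extended reals (at the lowest value of the support it can be
`-∞`). Where the two one-sided derivatives differ, the convention is as follows.
If `F` charges every interval `[z, y)` with `y > z`, then the quantiles just below `q` belong to
values that are equal to `z` or close to it, and the derivative is the one from the left; in
particular, an atom `z` gets the slope of the curve on its interval of quantiles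
`(Pr[v > z], Pr[v ≥ z])`. Otherwise `z` is a non-atomic upper end of a piece of the support, the
quantiles just below `q` (if any) belong to values beyond a gap, and the derivative is the one from
the right. The one-sided limits of the slopes exist since the curve is concave, so that `liminf` is
just the limit. -/
def ironedVirtualValue (F : Measure ℝ) (z : ℝ) : EReal :=
  let q := F.real (Ici z)
  if ∀ y > z, F (Ico z y) ≠ 0 then
    liminf (fun t => ((slope (ironedRevenueCurve F) q t : ℝ) : EReal)) (𝓝[<] q)
  else
    liminf (fun t => ((slope (ironedRevenueCurve F) q t : ℝ) : EReal)) (𝓝[>] q)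

/-! ### Mechanisms -/

/-- A (deterministic, direct) mechanism for the set `κ` of bidders: the set of winners and the
payments, as functions of the vector of bids. -/
structure Mechanism (κ : Type*) where
  /-- the set of winners -/
  alloc : (κ → ℝ) → Finset κ
  /-- the payment of each bidder -/
  pay : (κ → ℝ) → κ → ℝ

/-- The revenue at a vector of bids: the sum of all payments. -/
def Mechanism.revenue {κ : Type*} [Fintype κ] (A : Mechanism κ) (b : κ → ℝ) : ℝ :=
  ∑ i, A.pay b i

/-- `T` selects, for each vector `φ` of virtual values, a feasible set (a member of `I`) of
bidders with non-negative virtual values which has maximum total virtual value among all such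
sets. The selection among several maximizers is arbitrary, except that it is measurable and,
like the optimization problem, sees nothing but the virtual values. -/
structure IsOptimalSelection {κ : Type*} (I : Set (Finset κ))
    (T : (κ → EReal) → Finset κ) : Prop where
  feasible : ∀ φ, T φ ∈ I
  nonneg : ∀ φ, ∀ i ∈ T φ, 0 ≤ φ i
  optimal : ∀ φ, ∀ S ∈ I, (∀ i ∈ S, 0 ≤ φ i) →
    ∑ i ∈ S, (φ i).toReal ≤ ∑ i ∈ T φ, (φ i).toReal
  measurable : ∀ i, MeasurableSet {φ | i ∈ T φ}

open Classical in
/-- Myerson's optimal mechanism for the specified value distributions `F`, where `T` solves the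
optimization problem. The winners are selected by `T` from the ironed virtual values of the bids;
each winner pays the critical bid, the least report in the support of her distribution with which
she wins against the bids of the others; the losers pay nothing. -/
def myerOPT {κ : Type*} (F : κ → Measure ℝ) (T : (κ → EReal) → Finset κ) : Mechanism κ where
  alloc b := T fun i => ironedVirtualValue (F i) (b i)
  pay b i :=
    if i ∈ T (fun j => ironedVirtualValue (F j) (b j)) then
      sInf {z : ℝ | z ∈ (F i).support ∧
        i ∈ T (fun j => ironedVirtualValue (F j) (Function.update b i z j))}
    else 0

/-! ### Markets and colours -/

/-- The feasible sets of winners in a matroid market: the independent sets. -/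
def matroidMarket {ι : Type*} (M : Matroid ι) : Set (Finset ι) :=
  {S | M.Indep (S : Set ι)}

/-- The restriction of a set system to the bidders in `G`. -/
def restrictMarket {ι : Type*} (I : Set (Finset ι)) (G : Finset ι) :
    Set (Finset {i // i ∈ G}) :=
  {S | S.map (Function.Embedding.subtype fun i => i ∈ G) ∈ I}

open Classical in
/-- The vector of bids obtained by interleaving the bids of the green bidders, those in `G`, and
the bids of the red bidders. -/
def joinBids {ι : Type*} (G : Finset ι) (bG : {i // i ∈ G} → ℝ) (bR : {i // i ∉ G} → ℝ) : ι → ℝ :=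
  fun i => if h : i ∈ G then bG ⟨i, h⟩ else bR ⟨i, h⟩

end

/-!
The argument compares virtual surpluses. Three facts carry it.

**Myerson's lemma** (`IsValueDistribution.critical_bid_mul_prob` for one bidder,
`lintegral_criticalPayment` for all of them): the expected payment of a bidder is the expected
ironed virtual value with which she wins, provided that winning depends on the ironed virtual
values only and is monotone in her own. In quantile space the ironed virtual value at a quantile
`u ∈ (0, 1)` is a supergradient of the concave hull of the revenue curve
(`IsValueDistribution.exists_supergradient`), so its integral over the winning quantiles `(0, q)`
is the value of the hull at `q`. The threshold `q` is not inside an ironed interval, so the hull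
meets the revenue curve there, and `q` times the critical bid is the same number
(`IsValueDistribution.critical_bid_mul_threshold`). Gaps in the support do no harm: the revenue
curve drops where its value jumps over a gap, so that the curve is ironed across.

**Red payments.** A red winner pays at least the virtual value of every bidder she could be
exchanged for (`le_myerOPT_pay`). Each report `z` with which she wins has at least that virtual
value, since the total virtual value is maximized, and a non-negative ironed virtual value is at
most the value itself (`IsValueDistribution.ironedVirtualValue_le_self`).

**Exchange in the matroid.** For the green vector of bids fixed, let `S` be the winners of the full
market and `S'` those of the green market. By Hall's theorem the elements of `S'` spanned by `S`
can be charged injectively to elements of `S` which they can be exchanged for. A green `s ∈ S` has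
at least the virtual value of the bidder charged to her, by optimality, and a red one pays at least
as much. Hence the virtual surplus of `S'` is at most that of the green members of `S` plus the
payments of the red ones (`sum_virtualValues_le`).

Taking expectations and applying Myerson's lemma to the green bidders in both markets gives the
claim. All expectations are Lebesgue integrals of non-negative functions, so that no integrability
is needed; the red payments need not even be measurable.
-/

/-! ### Exchange in matroids and optimal selections -/

/-- If every element of the independent set `S'` spanned by `S` is charged to an element of its
fundamental circuit with respect to `S`, then the charges can be made injectively (Hall's theorem:
a set `X ⊆ S'` is spanned by the union of these circuits within `S`, so that union has at least
`#X` elements). -/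
lemma Matroid.exists_injective_mem_fundCircuit {α : Type*} (M : Matroid α) {S S' : Finset α}
    (hS : M.Indep (S : Set α)) (hS' : M.Indep (S' : Set α)) :
    ∃ f : {e // e ∈ S' ∧ e ∈ M.closure (S : Set α)} → α, Function.Injective f ∧
      ∀ e, f e ∈ S ∧ f e ∈ M.fundCircuit e S := by
  classical
  have key := (Finset.all_card_le_biUnion_card_iff_exists_injective
    (fun e : {e // e ∈ S' ∧ e ∈ M.closure (S : Set α)} =>
      S.filter (fun x => x ∈ M.fundCircuit (e : α) S))).1 ?_
  · obtain ⟨f, hf, h⟩ := key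
    exact ⟨f, hf, fun e => by simpa using h e⟩
  intro X
  set J := X.biUnion (fun e => S.filter (fun x => x ∈ M.fundCircuit (e : α) S)) with hJ
  have hJS : J ⊆ S := Finset.biUnion_subset.2 fun e _ => Finset.filter_subset _ _
  have hspan : ∀ e ∈ X, (e : α) ∈ M.closure (J : Set α) := by
    intro e he
    have hsub : (S : Set α) ∩ M.fundCircuit (e : α) S ⊆ J := by
      rintro x ⟨hx, hx'⟩
      simp only [hJ, Finset.coe_biUnion, mem_iUnion]
      exact ⟨e, he, by simpa using ⟨hx, hx'⟩⟩
    by_cases heS : (e : α) ∈ S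
    · refine M.mem_closure_of_mem' (hsub ⟨heS, M.mem_fundCircuit _ _⟩)
        (M.closure_subset_ground _ e.2.2)
    · have hC := hS.fundCircuit_isCircuit e.2.2 (by simpa using heS)
      refine M.closure_subset_closure ?_
        (hC.mem_closure_sdiff_singleton_of_mem (M.mem_fundCircuit (e : α) S))
      rintro x ⟨hx, hxe⟩
      refine hsub ⟨?_, hx⟩
      rcases M.fundCircuit_subset_insert (e : α) S hx with h | h
      · exact absurd h hxe
      · exact h
  have hXindep : M.Indep ((X.map (Function.Embedding.subtype _) : Finset α) : Set α) := by
    refine hS'.subset ?_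
    intro x hx
    simp only [Finset.coe_map, mem_image, Finset.mem_coe] at hx
    obtain ⟨e, _, rfl⟩ := hx
    exact e.2.1
  have h1 := hXindep.encard_le_eRk_of_subset (X := M.closure (J : Set α)) (by
    intro x hx
    simp only [Finset.coe_map, mem_image, Finset.mem_coe] at hx
    obtain ⟨e, he, rfl⟩ := hx
    exact hspan e he)
  rw [M.eRk_closure_eq] at h1
  have h2 := h1.trans (M.eRk_le_encard _)
  rw [Set.encard_coe_eq_coe_finsetCard, Set.encard_coe_eq_coe_finsetCard, Finset.card_map] at h2
  exact_mod_cast h2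

/-- If the value `c s` of each element of `S` is at least the weight of every element of `S'` which
`s` can be exchanged for, and if the elements of `S'` not spanned by `S` have no positive weight,
then the total weight of `S'` is at most the total value of `S`. -/
lemma Matroid.sum_le_sum_of_exchange {α : Type*} [DecidableEq α] (M : Matroid α)
    {S S' : Finset α}
    (hS : M.Indep (S : Set α)) (hS' : M.Indep (S' : Set α)) (w c : α → ℝ)
    (hc : ∀ s ∈ S, 0 ≤ c s) (h0 : ∀ e ∈ S', e ∉ S → M.Indep (insert e S : Finset α) → w e ≤ 0)
    (h1 : ∀ e ∈ S', e ∈ S → w e ≤ c e)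
    (h2 : ∀ e ∈ S', e ∉ S → ∀ s ∈ S, M.Indep (insert e (S.erase s) : Finset α) → w e ≤ c s) :
    ∑ e ∈ S', w e ≤ ∑ s ∈ S, c s := by
  classical
  have : Fintype {e // e ∈ S' ∧ e ∈ M.closure (S : Set α)} :=
    Fintype.subtype (S'.filter (fun e => e ∈ M.closure (S : Set α))) (by simp)
  obtain ⟨f, hf, hfS⟩ := M.exists_injective_mem_fundCircuit hS hS'
  have step1 : ∑ e ∈ S', w e ≤ ∑ e ∈ S' with e ∈ M.closure (S : Set α), w e := by
    rw [Finset.sum_filter]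
    refine Finset.sum_le_sum fun e he => ?_
    split_ifs with h
    · exact le_rfl
    · have heE : e ∈ M.E := hS'.subset_ground he
      have heS : e ∉ S := fun h' => h (M.mem_closure_of_mem' (by simpa using h') heE)
      refine h0 e he heS ?_
      rw [Finset.coe_insert]
      exact (hS.notMem_closure_iff_of_notMem (by simpa using heS)).1 h
  have step2 : ∑ e ∈ S' with e ∈ M.closure (S : Set α), w e
      = ∑ e : {e // e ∈ S' ∧ e ∈ M.closure (S : Set α)}, w e := by
    refine Finset.sum_subtype _ (fun x => by simp) w
  have step3 : ∀ e : {e // e ∈ S' ∧ e ∈ M.closure (S : Set α)}, w e ≤ c (f e) := by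
    intro e
    obtain ⟨hm, hC⟩ := hfS e
    by_cases heS : (e : α) ∈ S
    · rw [M.fundCircuit_eq_of_mem (by simpa using heS)] at hC
      rw [hC]
      exact h1 e e.2.1 heS
    · refine h2 e e.2.1 heS _ hm ?_
      have h := (hS.mem_fundCircuit_iff e.2.2 (by simpa using heS)).1 hC
      rw [← insert_sdiff_singleton_comm] at h
      · simpa using h
      · rintro h'
        exact heS (h' ▸ hm)
  rw [step2] at step1
  refine step1.trans ((Finset.sum_le_sum fun e _ => step3 e).trans ?_)
  rw [← Finset.sum_image (f := c) (s := Finset.univ) (g := f) (fun x _ y _ h => hf h)]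
  refine Finset.sum_le_sum_of_subset_of_nonneg ?_ fun s hs _ => hc s hs
  intro s hs
  simp only [Finset.mem_image, Finset.mem_univ, true_and] at hs
  obtain ⟨e, rfl⟩ := hs
  exact (hfS e).1

section Selection

variable {κ : Type*} {I : Set (Finset κ)} {T : (κ → EReal) → Finset κ}

lemma sum_toReal_update_of_notMem [DecidableEq κ] (φ : κ → EReal) {S : Finset κ} {i : κ}
    (hi : i ∉ S) (y : EReal) :
    ∑ j ∈ S, (Function.update φ i y j).toReal = ∑ j ∈ S, (φ j).toReal :=
  Finset.sum_congr rfl fun j hj => by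
    rw [Function.update_of_ne (ne_of_mem_of_not_mem hj hi)]

lemma sum_toReal_update_of_mem [DecidableEq κ] (φ : κ → EReal) {S : Finset κ} {i : κ}
    (hi : i ∈ S) (y : EReal) :
    ∑ j ∈ S, (Function.update φ i y j).toReal
      = ∑ j ∈ S, (φ j).toReal - (φ i).toReal + y.toReal := by
  rw [← Finset.add_sum_erase S _ hi, ← Finset.add_sum_erase S (fun j => (φ j).toReal) hi,
    sum_toReal_update_of_notMem φ (Finset.notMem_erase i S)]
  simp only [Function.update_self]
  ring

/-- Winning is monotone in one's own virtual value. -/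
lemma IsOptimalSelection.mem_update_of_le [DecidableEq κ] (hT : IsOptimalSelection I T)
    (φ : κ → EReal) (i : κ) {x y : ℝ} (hx : i ∈ T (Function.update φ i (x : EReal)))
    (hxy : x ≤ y) : i ∈ T (Function.update φ i (y : EReal)) := by
  by_contra hy
  have hx0 : 0 ≤ x := by simpa using hT.nonneg _ i hx
  have e1 := hT.optimal (Function.update φ i (x : EReal)) _ (hT.feasible (Function.update φ i y))
    (fun j hj => by
      have hji : j ≠ i := fun h => hy (h ▸ hj)
      simpa [hji] using hT.nonneg _ j hj)
  have e2 := hT.optimal (Function.update φ i (y : EReal)) _ (hT.feasible (Function.update φ i x))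
    (fun j hj => by
      by_cases hji : j = i
      · subst hji; simpa using hx0.trans hxy
      · simpa [hji] using hT.nonneg _ j hj)
  rw [sum_toReal_update_of_notMem φ hy, sum_toReal_update_of_mem φ hx] at e1 e2
  simp only [EReal.toReal_coe] at e1 e2
  have : x = y := by linarith
  exact hy (this ▸ hx)

/-- If the winner `s` still wins after her virtual value is replaced by `y`, then `y` is at least
the virtual value of every bidder `e` which `s` could be exchanged for: a feasible set that
contains `s` cannot do better than `S - s` together with `s`, and has to do as well as
`S - s + e`. -/
lemma IsOptimalSelection.le_of_mem_update [DecidableEq κ] (hT : IsOptimalSelection I T)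
    (φ : κ → EReal) {e s : κ} (he : e ∉ T φ) (hs : s ∈ T φ) (he0 : 0 ≤ φ e)
    (hI : insert e ((T φ).erase s) ∈ I) {y : EReal} (hy : s ∈ T (Function.update φ s y)) :
    (φ e).toReal ≤ y.toReal := by
  have hes : e ≠ s := fun h => he (h ▸ hs)
  have e1 := hT.optimal φ _ (hT.feasible (Function.update φ s y)) (fun j hj => by
    by_cases hjs : j = s
    · subst hjs; exact hT.nonneg _ _ hs
    · simpa [hjs] using hT.nonneg _ j hj)
  have e2 := hT.optimal (Function.update φ s y) _ hI (fun j hj => by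
    rw [Finset.mem_insert, Finset.mem_erase] at hj
    rcases hj with rfl | ⟨hjs, hj⟩
    · simpa [hes] using he0
    · simpa [hjs] using hT.nonneg _ j hj)
  rw [sum_toReal_update_of_mem φ hy, sum_toReal_update_of_notMem φ (by simp [hes.symm]),
    Finset.sum_insert (by simp [he])] at e2
  have := Finset.add_sum_erase (T φ) (fun j => (φ j).toReal) hs
  linarith

lemma IsOptimalSelection.le_of_exchange [DecidableEq κ] (hT : IsOptimalSelection I T)
    (φ : κ → EReal) {e s : κ} (he : e ∉ T φ) (hs : s ∈ T φ) (he0 : 0 ≤ φ e)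
    (hI : insert e ((T φ).erase s) ∈ I) : (φ e).toReal ≤ (φ s).toReal :=
  hT.le_of_mem_update φ he hs he0 hI (by simpa using hs)

lemma IsOptimalSelection.le_zero_of_insert [DecidableEq κ] (hT : IsOptimalSelection I T)
    (φ : κ → EReal) {e : κ} (he : e ∉ T φ) (he0 : 0 ≤ φ e)
    (hI : insert e (T φ) ∈ I) : (φ e).toReal ≤ 0 := by
  have e1 := hT.optimal φ _ hI (fun j hj => by
    rw [Finset.mem_insert] at hj
    rcases hj with rfl | hj
    · exact he0
    · exact hT.nonneg _ j hj)
  rw [Finset.sum_insert he] at e1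
  linarith

end Selection

/-! ### The revenue curve and its concave hull -/

/-- A distribution of values: it lives on `[0, ∞)` and the revenue of a posted price `z` tends to
`0` as `z → ∞`. -/
structure IsValueDistribution (F : Measure ℝ) : Prop where
  nonneg : F (Iio 0) = 0
  tail : Tendsto (fun z : ℝ => z * F.real (Ici z)) atTop (𝓝 0)

namespace IsValueDistribution

variable {F : Measure ℝ}

lemma exists_real_Ici_lt (hF : IsValueDistribution F) {q : ℝ} (hq : 0 < q) :
    ∃ Z : ℝ, ∀ z ≥ Z, F.real (Ici z) < q := by
  obtain ⟨Z, hZ⟩ := eventually_atTop.1 (hF.tail.eventually_lt_const hq)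
  refine ⟨max Z 1, fun z hz => ?_⟩
  have h1 := hZ z ((le_max_left _ _).trans hz)
  have h2 : 1 ≤ z := (le_max_right _ _).trans hz
  have h3 : 0 ≤ F.real (Ici z) := measureReal_nonneg
  nlinarith

lemma bddAbove_quantile (hF : IsValueDistribution F) {q : ℝ} (hq : 0 < q) :
    BddAbove {y : ℝ | q ≤ F.real (Ici y)} := by
  obtain ⟨Z, hZ⟩ := hF.exists_real_Ici_lt hq
  refine ⟨Z, fun y hy => ?_⟩
  by_contra! h
  exact absurd (hZ y h.le) (not_lt.2 hy)

lemma concaveOn_affine (m s : ℝ) : ConcaveOn ℝ (Icc (0 : ℝ) 1) fun t => m + s * t :=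
  ⟨convex_Icc 0 1, fun x _ y _ a b _ _ hab => by
    simp only [smul_eq_mul]
    apply le_of_eq
    linear_combination m * hab⟩

lemma bddBelow_majorant (F : Measure ℝ) {q : ℝ} (hq : q ∈ Icc (0 : ℝ) 1) :
    BddBelow {r : ℝ | ∃ g : ℝ → ℝ, ConcaveOn ℝ (Icc 0 1) g ∧
      (∀ t ∈ Icc (0 : ℝ) 1, revenueCurve F t ≤ g t) ∧ r = g q} :=
  ⟨revenueCurve F q, fun _ ⟨_, _, hg, hr⟩ => hr ▸ hg q hq⟩

lemma ironedRevenueCurve_le {g : ℝ → ℝ} (hg : ConcaveOn ℝ (Icc 0 1) g)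
    (hRg : ∀ t ∈ Icc (0 : ℝ) 1, revenueCurve F t ≤ g t) {q : ℝ} (hq : q ∈ Icc (0 : ℝ) 1) :
    ironedRevenueCurve F q ≤ g q :=
  csInf_le (bddBelow_majorant F hq) ⟨g, hg, hRg, rfl⟩

variable [IsProbabilityMeasure F]

lemma real_Ici_anti {y z : ℝ} (h : y ≤ z) : F.real (Ici z) ≤ F.real (Ici y) :=
  measureReal_mono (Ici_subset_Ici.2 h)

lemma real_Ici_add_Ico {y z : ℝ} (h : y ≤ z) :
    F.real (Ici y) = F.real (Ico y z) + F.real (Ici z) := by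
  rw [← measureReal_union _ measurableSet_Ici, Ico_union_Ici_eq_Ici h]
  exact Set.disjoint_left.2 fun x hx hx' => not_lt.2 hx' hx.2

lemma real_Ici_zero (hF : IsValueDistribution F) : F.real (Ici 0) = 1 := by
  have h : F.real (Iio (0 : ℝ))ᶜ = 1 - F.real (Iio (0 : ℝ)) :=
    probReal_compl_eq_one_sub measurableSet_Iio
  rw [compl_Iio] at h
  rw [h, measureReal_def, hF.nonneg]
  simp

/-- The Galois connection between quantiles and values. -/
lemma le_quantileValue_iff (hF : IsValueDistribution F) {q y : ℝ} (hq : 0 < q) (hq1 : q ≤ 1) :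
    y ≤ quantileValue F q ↔ q ≤ F.real (Ici y) := by
  have hbdd := hF.bddAbove_quantile hq
  refine ⟨fun hy => ?_, fun hy => le_csSup hbdd hy⟩
  refine le_trans ?_ (real_Ici_anti hy)
  -- `y ↦ Pr[v ≥ y]` is continuous from the left
  obtain ⟨u, hmono, hu, hulim⟩ := exists_seq_strictMono_tendsto (quantileValue F q)
  have hI : ⋂ n, Ici (u n) = Ici (quantileValue F q) := by
    ext x
    simp only [mem_iInter, mem_Ici]
    exact ⟨fun h => le_of_tendsto' hulim h, fun h n => (hu n).le.trans h⟩
  have hlim : Tendsto (fun n => F (Ici (u n))) atTop (𝓝 (F (⋂ n, Ici (u n)))) :=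
    tendsto_measure_iInter_atTop (fun n => measurableSet_Ici.nullMeasurableSet)
      (fun m n h => Ici_subset_Ici.2 (hmono.monotone h)) ⟨0, measure_ne_top _ _⟩
  rw [hI] at hlim
  have hlim' : Tendsto (fun n => F.real (Ici (u n))) atTop
      (𝓝 (F.real (Ici (quantileValue F q)))) :=
    (ENNReal.tendsto_toReal (measure_ne_top _ _)).comp hlim
  refine ge_of_tendsto' hlim' fun n => ?_
  obtain ⟨z, hz, huz⟩ := exists_lt_of_lt_csSup
    (⟨0, by simpa [hF.real_Ici_zero] using hq1⟩ : {y : ℝ | q ≤ F.real (Ici y)}.Nonempty) (hu n)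
  exact le_trans hz (real_Ici_anti huz.le)

lemma le_real_Ici_quantileValue (hF : IsValueDistribution F) {q : ℝ} (hq : 0 < q) (hq1 : q ≤ 1) :
    q ≤ F.real (Ici (quantileValue F q)) :=
  (hF.le_quantileValue_iff hq hq1).1 le_rfl

lemma quantileValue_lt_iff (hF : IsValueDistribution F) {q y : ℝ} (hq : 0 < q) (hq1 : q ≤ 1) :
    quantileValue F q < y ↔ F.real (Ici y) < q := by
  rw [← not_le, hF.le_quantileValue_iff hq hq1, not_le]

lemma quantileValue_nonneg (hF : IsValueDistribution F) {q : ℝ} (hq : 0 < q) (hq1 : q ≤ 1) :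
    0 ≤ quantileValue F q := by
  rw [hF.le_quantileValue_iff hq hq1, hF.real_Ici_zero]
  exact hq1

lemma quantileValue_anti (hF : IsValueDistribution F) {q q' : ℝ} (hq : 0 < q) (hqq' : q ≤ q')
    (hq1 : q' ≤ 1) : quantileValue F q' ≤ quantileValue F q := by
  rw [hF.le_quantileValue_iff hq (hqq'.trans hq1)]
  exact hqq'.trans (hF.le_real_Ici_quantileValue (hq.trans_le hqq') hq1)

lemma revenueCurve_nonneg (hF : IsValueDistribution F) {q : ℝ} (hq : 0 ≤ q) (hq1 : q ≤ 1) :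
    0 ≤ revenueCurve F q := by
  rcases hq.eq_or_lt with rfl | hq
  · simp [revenueCurve]
  · exact mul_nonneg hq.le (hF.quantileValue_nonneg hq hq1)

/-- Near quantile `0` the revenue is small: this is the tail condition. -/
lemma exists_revenueCurve_le (hF : IsValueDistribution F) {ε : ℝ} (hε : 0 < ε) :
    ∃ Z : ℝ, 0 < Z ∧ ∀ q, 0 ≤ q → q ≤ 1 → revenueCurve F q ≤ ε + Z * q := by
  obtain ⟨Z, hZ⟩ := eventually_atTop.1 (hF.tail.eventually_le_const hε)
  refine ⟨max Z 1, by positivity, fun q hq hq1 => ?_⟩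
  rcases hq.eq_or_lt with rfl | hq
  · simpa [revenueCurve] using hε.le
  have hv := hF.quantileValue_nonneg hq hq1
  rcases le_total (quantileValue F q) (max Z 1) with h | h
  · have : q * quantileValue F q ≤ q * max Z 1 := by gcongr
    rw [revenueCurve]
    linarith
  · have h1 := hZ _ ((le_max_left _ _).trans h)
    have h2 : quantileValue F q * q ≤ quantileValue F q * F.real (Ici (quantileValue F q)) := by
      gcongr
      exact hF.le_real_Ici_quantileValue hq hq1
    have h3 : 0 ≤ max Z 1 * q := by positivity
    rw [revenueCurve]
    linarith

/-- The revenue curve is upper semicontinuous at positive quantiles. -/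
lemma exists_revenueCurve_lt (hF : IsValueDistribution F) {q c : ℝ} (hq : 0 < q) (hq1 : q ≤ 1)
    (hc : revenueCurve F q < c) :
    ∃ a b : ℝ, 0 < a ∧ a < q ∧ q < b ∧ ∀ t, a ≤ t → t ≤ b → t ≤ 1 → revenueCurve F t < c := by
  rw [revenueCurve, mul_comm, ← lt_div_iff₀ hq] at hc
  obtain ⟨y, hy, hyc⟩ := exists_between hc
  have hy0 : 0 < y := (hF.quantileValue_nonneg hq hq1).trans_lt hy
  rw [lt_div_iff₀ hq, mul_comm, ← lt_div_iff₀ hy0] at hyc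
  obtain ⟨b, hqb, hb⟩ := exists_between hyc
  rw [lt_div_iff₀ hy0] at hb
  rw [hF.quantileValue_lt_iff hq hq1] at hy
  obtain ⟨a, ha, haq⟩ := exists_between hy
  have ha0 : 0 < a := measureReal_nonneg.trans_lt ha
  refine ⟨a, b, ha0, haq, hqb, fun t hat htb ht1 => ?_⟩
  have ht0 : 0 < t := ha0.trans_le hat
  have : quantileValue F t < y :=
    (hF.quantileValue_anti ha0 hat ht1).trans_lt
      ((hF.quantileValue_lt_iff ha0 (haq.le.trans hq1)).2 ha)
  calc revenueCurve F t ≤ t * y := by rw [revenueCurve]; gcongr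
    _ ≤ b * y := by gcongr
    _ < c := hb

lemma le_ironedRevenueCurve_of_forall (hF : IsValueDistribution F) {q c : ℝ}
    (h : ∀ g : ℝ → ℝ, ConcaveOn ℝ (Icc 0 1) g →
      (∀ t ∈ Icc (0 : ℝ) 1, revenueCurve F t ≤ g t) → c ≤ g q) :
    c ≤ ironedRevenueCurve F q := by
  obtain ⟨Z, -, hZ⟩ := hF.exists_revenueCurve_le one_pos
  refine le_csInf ⟨_, _, concaveOn_affine 1 Z, fun t ht => hZ t ht.1 ht.2, rfl⟩ ?_
  rintro _ ⟨g, hg, hRg, rfl⟩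
  exact h g hg hRg

lemma revenueCurve_le_ironed (hF : IsValueDistribution F) {q : ℝ} (hq : q ∈ Icc (0 : ℝ) 1) :
    revenueCurve F q ≤ ironedRevenueCurve F q :=
  hF.le_ironedRevenueCurve_of_forall fun _ _ hg => hg q hq

lemma concaveOn_ironedRevenueCurve (hF : IsValueDistribution F) :
    ConcaveOn ℝ (Icc 0 1) (ironedRevenueCurve F) := by
  refine ⟨convex_Icc 0 1, fun x hx y hy a b ha hb hab => ?_⟩
  refine hF.le_ironedRevenueCurve_of_forall fun g hg hRg => ?_
  refine le_trans ?_ (hg.2 hx hy ha hb hab)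
  have h1 := ironedRevenueCurve_le hg hRg hx
  have h2 := ironedRevenueCurve_le hg hRg hy
  simp only [smul_eq_mul]
  gcongr

/-- An affine function `L` which is above the revenue curve wherever it is below the hull is above
the hull: the minimum of `L` and the hull is a concave majorant. -/
lemma ironedRevenueCurve_le_affine (hF : IsValueDistribution F) (m s : ℝ)
    (h : ∀ t ∈ Icc (0 : ℝ) 1, m + s * t < ironedRevenueCurve F t → revenueCurve F t ≤ m + s * t)
    {q : ℝ} (hq : q ∈ Icc (0 : ℝ) 1) : ironedRevenueCurve F q ≤ m + s * q := by
  refine (ironedRevenueCurve_le (hF.concaveOn_ironedRevenueCurve.inf (concaveOn_affine m s))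
    (fun t ht => le_inf (hF.revenueCurve_le_ironed ht) ?_) hq).trans inf_le_right
  rcases lt_or_ge (m + s * t) (ironedRevenueCurve F t) with hlt | hge
  · exact h t ht hlt
  · exact (hF.revenueCurve_le_ironed ht).trans hge

lemma ironedRevenueCurve_le_affine' (hF : IsValueDistribution F) (m s : ℝ)
    (h : ∀ t ∈ Icc (0 : ℝ) 1, revenueCurve F t ≤ m + s * t)
    {q : ℝ} (hq : q ∈ Icc (0 : ℝ) 1) : ironedRevenueCurve F q ≤ m + s * q :=
  hF.ironedRevenueCurve_le_affine m s (fun t ht _ => h t ht) hq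

lemma ironedRevenueCurve_nonneg (hF : IsValueDistribution F) {q : ℝ} (hq : q ∈ Icc (0 : ℝ) 1) :
    0 ≤ ironedRevenueCurve F q :=
  (hF.revenueCurve_nonneg hq.1 hq.2).trans (hF.revenueCurve_le_ironed hq)

lemma ironedRevenueCurve_zero (hF : IsValueDistribution F) : ironedRevenueCurve F 0 = 0 := by
  refine le_antisymm (le_of_forall_pos_le_add fun ε hε => ?_)
    (hF.ironedRevenueCurve_nonneg (by simp))
  obtain ⟨Z, -, hZ⟩ := hF.exists_revenueCurve_le hε
  simpa using hF.ironedRevenueCurve_le_affine' ε Z (fun t ht => hZ t ht.1 ht.2)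
    (q := 0) (by simp)

/-- A steep line through a point just above the right end of the revenue curve dominates the
curve. -/
lemma exists_affine_majorant_one (hF : IsValueDistribution F) {c : ℝ}
    (hc : revenueCurve F 1 < c) :
    ∃ K : ℝ, ∀ t ∈ Icc (0 : ℝ) 1, ironedRevenueCurve F t ≤ c + K * (1 - t) := by
  obtain ⟨Z, hZ, hZ'⟩ := hF.exists_revenueCurve_le one_pos
  obtain ⟨a, b, ha, ha1, hb, hab⟩ := hF.exists_revenueCurve_lt one_pos le_rfl hc
  have hc0 : 0 < c := (hF.revenueCurve_nonneg zero_le_one le_rfl).trans_lt hc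
  have h1a : 0 < 1 - a := by linarith
  refine ⟨(1 + Z) / (1 - a), fun t ht => ?_⟩
  have hK : 0 ≤ (1 + Z) / (1 - a) := by positivity
  have := hF.ironedRevenueCurve_le_affine' (c + (1 + Z) / (1 - a)) (-((1 + Z) / (1 - a))) ?_ ht
  · linarith
  intro t ht
  rcases le_total a t with h | h
  · have h1 := hab t h (ht.2.trans hb.le) ht.2
    have : 0 ≤ (1 + Z) / (1 - a) * (1 - t) := mul_nonneg hK (by linarith [ht.2])
    linarith
  · have h1 := hZ' t ht.1 ht.2
    have h2 : (1 + Z) / (1 - a) * (1 - a) ≤ (1 + Z) / (1 - a) * (1 - t) := by gcongr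
    rw [div_mul_cancel₀ _ h1a.ne'] at h2
    have : Z * t ≤ Z * 1 := by gcongr; exact ht.2
    linarith

lemma ironedRevenueCurve_one (hF : IsValueDistribution F) :
    ironedRevenueCurve F 1 = revenueCurve F 1 := by
  refine le_antisymm (le_of_forall_gt_imp_ge_of_dense fun c hc => ?_)
    (hF.revenueCurve_le_ironed (by simp))
  obtain ⟨K, hK⟩ := hF.exists_affine_majorant_one hc
  simpa using hK 1 (by simp)

lemma continuousOn_ironedRevenueCurve (hF : IsValueDistribution F) :
    ContinuousOn (ironedRevenueCurve F) (Icc 0 1) := by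
  intro x hx
  rcases hx.1.eq_or_lt with rfl | hx0
  · rw [ContinuousWithinAt, hF.ironedRevenueCurve_zero, Metric.tendsto_nhdsWithin_nhds]
    intro ε hε
    obtain ⟨Z, hZ, hZ'⟩ := hF.exists_revenueCurve_le (half_pos hε)
    refine ⟨ε / 2 / Z, by positivity, fun t ht hd => ?_⟩
    have h1 := hF.ironedRevenueCurve_le_affine' (ε / 2) Z (fun t ht => hZ' t ht.1 ht.2) ht
    rw [Real.dist_eq, sub_zero, abs_of_nonneg ht.1, lt_div_iff₀ hZ] at hd
    rw [Real.dist_eq, sub_zero, abs_of_nonneg (hF.ironedRevenueCurve_nonneg ht)]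
    linarith
  rcases hx.2.eq_or_lt with rfl | hx1
  · rw [ContinuousWithinAt, hF.ironedRevenueCurve_one]
    refine tendsto_order.2 ⟨fun c hc => ?_, fun c hc => ?_⟩
    · have h1 : Tendsto (fun t : ℝ => t * quantileValue F 1) (𝓝[Icc 0 1] 1)
          (𝓝 (1 * quantileValue F 1)) :=
        ((continuous_id.mul continuous_const).tendsto _).mono_left nhdsWithin_le_nhds
      have h2 : ∀ᶠ t : ℝ in 𝓝[Icc 0 1] 1, 0 < t :=
        (eventually_gt_nhds one_pos).filter_mono nhdsWithin_le_nhds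
      filter_upwards [h1.eventually_const_lt hc, self_mem_nhdsWithin, h2] with t ht ht' ht0
      refine ht.trans_le (le_trans ?_ (hF.revenueCurve_le_ironed ht'))
      rw [revenueCurve]
      gcongr
      exact hF.quantileValue_anti ht0 ht'.2 le_rfl
    · obtain ⟨c', hc', hcc'⟩ := exists_between hc
      obtain ⟨K, hK⟩ := hF.exists_affine_majorant_one hc'
      have h1 : Tendsto (fun t : ℝ => c' + K * (1 - t)) (𝓝[Icc 0 1] 1) (𝓝 (c' + K * (1 - 1))) :=
        (Continuous.tendsto (by fun_prop) _).mono_left nhdsWithin_le_nhds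
      filter_upwards [h1.eventually_lt_const (by simpa using hcc'), self_mem_nhdsWithin]
        with t ht ht'
      exact (hK t ht').trans_lt ht
  · have h := hF.concaveOn_ironedRevenueCurve.continuousOn_interior
    rw [interior_Icc] at h
    exact (h.continuousAt (Ioo_mem_nhds hx0 hx1)).continuousWithinAt

end IsValueDistribution

/-! ### Ironed virtual values as supergradients -/

section OneSided

variable {f : ℝ → ℝ} {q : ℝ}

lemma ConcaveOn.liminf_slope_left_le (hf : ConcaveOn ℝ (Icc 0 1) f) {t : ℝ} (ht : 0 ≤ t)
    (htq : t < q) (hq1 : q ≤ 1) :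
    liminf (fun t => ((slope f q t : ℝ) : EReal)) (𝓝[<] q) ≤ (slope f q t : ℝ) := by
  refine liminf_le_of_frequently_le' (Eventually.frequently ?_)
  filter_upwards [Ioo_mem_nhdsLT htq] with r hr
  exact EReal.coe_le_coe_iff.2 (hf.slope_anti ⟨ht.trans htq.le, hq1⟩
    ⟨⟨ht, htq.le.trans hq1⟩, htq.ne⟩ ⟨⟨ht.trans hr.1.le, hr.2.le.trans hq1⟩, hr.2.ne⟩ hr.1.le)

lemma le_liminf_slope_left (hq : 0 < q) {s : EReal}
    (h : ∀ t, 0 ≤ t → t < q → s ≤ (slope f q t : ℝ)) :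
    s ≤ liminf (fun t => ((slope f q t : ℝ) : EReal)) (𝓝[<] q) := by
  refine le_liminf_of_le (by isBoundedDefault) ?_
  filter_upwards [Ioo_mem_nhdsLT hq] with r hr
  exact h r hr.1.le hr.2

lemma ConcaveOn.le_liminf_slope_right (hf : ConcaveOn ℝ (Icc 0 1) f) {t : ℝ} (hq : 0 ≤ q)
    (hqt : q < t) (ht : t ≤ 1) :
    ((slope f q t : ℝ) : EReal) ≤ liminf (fun t => ((slope f q t : ℝ) : EReal)) (𝓝[>] q) := by
  refine le_liminf_of_le (by isBoundedDefault) ?_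
  filter_upwards [Ioo_mem_nhdsGT hqt] with r hr
  exact EReal.coe_le_coe_iff.2 (hf.slope_anti ⟨hq, hqt.le.trans ht⟩
    ⟨⟨hq.trans hr.1.le, hr.2.le.trans ht⟩, hr.1.ne'⟩ ⟨⟨hq.trans hqt.le, ht⟩, hqt.ne'⟩ hr.2.le)

lemma liminf_slope_right_le (hq : q < 1) {s : EReal}
    (h : ∀ t, q < t → t ≤ 1 → ((slope f q t : ℝ) : EReal) ≤ s) :
    liminf (fun t => ((slope f q t : ℝ) : EReal)) (𝓝[>] q) ≤ s := by
  refine liminf_le_of_frequently_le' (Eventually.frequently ?_)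
  filter_upwards [Ioo_mem_nhdsGT hq] with r hr
  exact h r hr.1 hr.2.le

end OneSided

namespace IsValueDistribution

variable {F : Measure ℝ} {z : ℝ}

lemma ironedVirtualValue_of_forall (h : ∀ y > z, F (Ico z y) ≠ 0) :
    ironedVirtualValue F z = liminf (fun t => ((slope (ironedRevenueCurve F) (F.real (Ici z)) t : ℝ)
      : EReal)) (𝓝[<] (F.real (Ici z))) := by
  rw [ironedVirtualValue, if_pos h]

lemma ironedVirtualValue_of_not_forall (h : ¬ ∀ y > z, F (Ico z y) ≠ 0) :
    ironedVirtualValue F z = liminf (fun t => ((slope (ironedRevenueCurve F) (F.real (Ici z)) t : ℝ)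
      : EReal)) (𝓝[>] (F.real (Ici z))) := by
  rw [ironedVirtualValue, if_neg h]

lemma nonneg_of_mem_support (hF : IsValueDistribution F) (hz : z ∈ F.support) : 0 ≤ z := by
  by_contra! h
  exact ((Measure.mem_support_iff_forall z).1 hz _ (Iio_mem_nhds h)).ne' hF.nonneg

variable [IsProbabilityMeasure F]

lemma real_Ici_pos_of_forall (h : ∀ y > z, F (Ico z y) ≠ 0) : 0 < F.real (Ici z) := by
  rw [measureReal_def, ENNReal.toReal_pos_iff]
  refine ⟨pos_iff_ne_zero.2 fun h0 => h (z + 1) (by linarith) ?_, measure_lt_top _ _⟩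
  exact measure_mono_null Ico_subset_Ici_self h0

lemma real_Ici_lt_one_of_not_forall (hz : z ∈ F.support) (h : ¬ ∀ y > z, F (Ico z y) ≠ 0) :
    F.real (Ici z) < 1 := by
  push Not at h
  obtain ⟨y, hy, h0⟩ := h
  have h1 : 0 < F (Iio y) := (Measure.mem_support_iff_forall z).1 hz _ (Iio_mem_nhds hy)
  rw [← Iio_union_Ico_eq_Iio hy.le] at h1
  have h2 : 0 < F (Iio z) := by
    refine pos_iff_ne_zero.2 fun h2 => h1.ne' (measure_union_null h2 h0)
  have h3 : F.real (Iio z)ᶜ = 1 - F.real (Iio z) := probReal_compl_eq_one_sub measurableSet_Iio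
  rw [compl_Iio] at h3
  have h4 : 0 < F.real (Iio z) := ENNReal.toReal_pos h2.ne' (measure_ne_top _ _)
  linarith

lemma Ico_quantileValue_ne_zero (hF : IsValueDistribution F) {u : ℝ} (hu : 0 < u) (hu1 : u ≤ 1) :
    ∀ y > quantileValue F u, F (Ico (quantileValue F u) y) ≠ 0 := by
  intro y hy h0
  have h1 := real_Ici_add_Ico (F := F) hy.le
  rw [measureReal_def (s := Ico _ _), h0] at h1
  have h2 := hF.le_real_Ici_quantileValue hu hu1
  have h3 := (hF.quantileValue_lt_iff hu hu1).1 hy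
  simp at h1
  linarith

lemma quantileValue_mem_support (hF : IsValueDistribution F) {u : ℝ} (hu : 0 < u) (hu1 : u ≤ 1) :
    quantileValue F u ∈ F.support := by
  rw [Measure.mem_support_iff_forall]
  intro U hU
  obtain ⟨l, r, hlr, hsub⟩ := mem_nhds_iff_exists_Ioo_subset.1 hU
  refine pos_iff_ne_zero.2 fun h0 => hF.Ico_quantileValue_ne_zero hu hu1 r hlr.2 ?_
  exact measure_mono_null ((Ico_subset_Ioo_left hlr.1).trans hsub) h0

/-- Ironing: where the revenue curve is below a chord of its hull, the hull is that chord. -/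
lemma ironedRevenueCurve_le_chord (hF : IsValueDistribution F) {a b : ℝ} (ha : 0 ≤ a)
    (hab : a < b) (hb : b ≤ 1)
    (h : ∀ t, a ≤ t → t ≤ b → revenueCurve F t
      ≤ ironedRevenueCurve F a + slope (ironedRevenueCurve F) a b * (t - a))
    {y : ℝ} (hy : y ∈ Icc (0 : ℝ) 1) :
    ironedRevenueCurve F y
      ≤ ironedRevenueCurve F a + slope (ironedRevenueCurve F) a b * (y - a) := by
  have hconc := hF.concaveOn_ironedRevenueCurve
  have ha' : a ∈ Icc (0 : ℝ) 1 := ⟨ha, hab.le.trans hb⟩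
  have hb' : b ∈ Icc (0 : ℝ) 1 := ⟨ha.trans hab.le, hb⟩
  set f := ironedRevenueCurve F with hf
  set s := slope f a b with hs
  have := hF.ironedRevenueCurve_le_affine (f a - s * a) s (fun t ht hlt' => ?_) hy
  · linarith
  -- a concave function is below the line through `a` and `b` outside `[a, b]`
  have key : a ≤ t ∧ t ≤ b := by
    constructor <;> by_contra! hcon
    · have := hconc.slope_anti ha' ⟨ht, hcon.ne⟩ ⟨hb', hab.ne'⟩ (hcon.le.trans hab.le)
      rw [← hs, slope_def_field, le_div_iff_of_neg (by linarith)] at this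
      linarith
    · have := hconc.slope_anti ha' ⟨hb', hab.ne'⟩ ⟨ht, (hab.trans hcon).ne'⟩ hcon.le
      rw [← hs, slope_def_field, div_le_iff₀ (by linarith)] at this
      linarith
  linarith [h t key.1 key.2]

/-- A line with values `≥ t * z` at both ends of an interval has values `≥ t * z` throughout. -/
lemma mul_le_chord {f : ℝ → ℝ} {a b z t : ℝ} (hab : a < b) (ha : a * z ≤ f a) (hb : b * z ≤ f b)
    (hat : a ≤ t) (htb : t ≤ b) : t * z ≤ f a + slope f a b * (t - a) := by
  have hba : 0 < b - a := sub_pos.2 hab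
  have e : (b - a) * (f a + slope f a b * (t - a) - t * z)
      = (b - t) * (f a - a * z) + (t - a) * (f b - b * z) := by
    rw [slope_def_field]
    field_simp
    ring
  have : 0 ≤ (b - a) * (f a + slope f a b * (t - a) - t * z) := by
    rw [e]
    exact add_nonneg (mul_nonneg (by linarith) (by linarith))
      (mul_nonneg (by linarith) (by linarith))
  have := nonneg_of_mul_nonneg_right this hba
  linarith

/-- The curve is ironed between the quantile `u` and the largest quantile with the same value, so
that the ironed virtual value of the value at the quantile `u` is always the slope of a supporting
line at `u` itself. -/
lemma exists_supergradient (hF : IsValueDistribution F) {u : ℝ} (hu : u ∈ Ioo (0 : ℝ) 1) :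
    ∃ s : ℝ, ironedVirtualValue F (quantileValue F u) = s ∧
      ∀ y ∈ Icc (0 : ℝ) 1,
        ironedRevenueCurve F y ≤ ironedRevenueCurve F u + s * (y - u) := by
  have hleft := hF.Ico_quantileValue_ne_zero hu.1 hu.2.le
  have hconc := hF.concaveOn_ironedRevenueCurve
  rw [ironedVirtualValue_of_forall hleft]
  have huq := hF.le_real_Ici_quantileValue hu.1 hu.2.le
  have hq1 : F.real (Ici (quantileValue F u)) ≤ 1 := measureReal_le_one
  set z := quantileValue F u with hz
  set q := F.real (Ici z) with hq
  set f := ironedRevenueCurve F with hf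
  rcases huq.eq_or_lt with heq | hlt
  · rw [← heq]
    set d := liminf (fun t => ((slope f u t : ℝ) : EReal)) (𝓝[<] u) with hd
    have h1 : ∀ t, 0 ≤ t → t < u → d ≤ (slope f u t : ℝ) := fun t ht htu =>
      hconc.liminf_slope_left_le ht htu hu.2.le
    have h2 : ∀ t, u < t → t ≤ 1 → ((slope f u t : ℝ) : EReal) ≤ d := fun t hut ht =>
      le_liminf_slope_left hu.1 fun r hr hru => EReal.coe_le_coe_iff.2
        (hconc.slope_anti ⟨hu.1.le, hu.2.le⟩ ⟨⟨hr, hru.le.trans hu.2.le⟩, hru.ne⟩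
          ⟨⟨hu.1.le.trans hut.le, ht⟩, hut.ne'⟩ (hru.le.trans hut.le))
    have hdtop : d ≠ ⊤ := ((h1 0 le_rfl hu.1).trans_lt (EReal.coe_lt_top _)).ne
    have hdbot : d ≠ ⊥ := ((EReal.bot_lt_coe _).trans_le (h2 1 hu.2 le_rfl)).ne'
    clear_value d
    lift d to ℝ using ⟨hdtop, hdbot⟩
    refine ⟨d, rfl, fun y hy => ?_⟩
    rcases lt_trichotomy y u with hyu | rfl | hyu
    · have := EReal.coe_le_coe_iff.1 (h1 y hy.1 hyu)
      rw [slope_def_field, le_div_iff_of_neg (by linarith)] at this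
      linarith
    · simp
    · have := EReal.coe_le_coe_iff.1 (h2 y hyu hy.2)
      rw [slope_def_field, div_le_iff₀ (by linarith)] at this
      linarith
  · have hv : ∀ t, u ≤ t → t ≤ q → revenueCurve F t = t * z := fun t hut htq => by
      have ht0 : 0 < t := hu.1.trans_le hut
      rw [revenueCurve, le_antisymm (hF.quantileValue_anti hu.1 hut (htq.trans hq1))
        ((hF.le_quantileValue_iff ht0 (htq.trans hq1)).2 htq)]
    have hfu : u * z ≤ f u :=
      hv u le_rfl huq ▸ hF.revenueCurve_le_ironed ⟨hu.1.le, hu.2.le⟩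
    have hfq : q * z ≤ f q :=
      hv q huq le_rfl ▸ hF.revenueCurve_le_ironed ⟨hu.1.le.trans huq, hq1⟩
    set s := slope f u q with hs
    have hfq2 : f q = f u + s * (q - u) := by
      rw [hs, slope_def_field, div_mul_cancel₀ _ (sub_pos.2 hlt).ne']
      ring
    have hsuper : ∀ y ∈ Icc (0 : ℝ) 1, f y ≤ f u + s * (y - u) := fun y hy =>
      hF.ironedRevenueCurve_le_chord hu.1.le hlt hq1
        (fun t h1 h2 => (hv t h1 h2).trans_le (mul_le_chord hlt hfu hfq h1 h2)) hy
    refine ⟨s, le_antisymm ?_ ?_, hsuper⟩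
    · refine (hconc.liminf_slope_left_le hu.1.le hlt hq1).trans_eq ?_
      rw [slope_comm]
    · refine le_liminf_slope_left (hu.1.trans hlt) fun t ht htq => ?_
      refine EReal.coe_le_coe_iff.2 ?_
      rw [slope_def_field, le_div_iff_of_neg (by linarith)]
      have := hsuper t ⟨ht, htq.le.trans hq1⟩
      linarith

/-- The ironed virtual value at the quantile `u ∈ (0, 1)`. -/
noncomputable def _root_.quantileVirtualValue (F : Measure ℝ) (u : ℝ) : ℝ :=
  (ironedVirtualValue F (quantileValue F u)).toReal

lemma coe_quantileVirtualValue (hF : IsValueDistribution F) {u : ℝ} (hu : u ∈ Ioo (0 : ℝ) 1) :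
    ironedVirtualValue F (quantileValue F u) = quantileVirtualValue F u := by
  obtain ⟨s, hs, -⟩ := hF.exists_supergradient hu
  rw [quantileVirtualValue, hs, EReal.toReal_coe]

lemma ironedRevenueCurve_le_supporting_line (hF : IsValueDistribution F) {u y : ℝ}
    (hu : u ∈ Ioo (0 : ℝ) 1) (hy : y ∈ Icc (0 : ℝ) 1) :
    ironedRevenueCurve F y ≤ ironedRevenueCurve F u + quantileVirtualValue F u * (y - u) := by
  obtain ⟨s, hs, h⟩ := hF.exists_supergradient hu
  rw [quantileVirtualValue, hs, EReal.toReal_coe]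
  exact h y hy

lemma quantileVirtualValue_antitoneOn (hF : IsValueDistribution F) :
    AntitoneOn (quantileVirtualValue F) (Ioo 0 1) := by
  intro u hu u' hu' huu'
  rcases huu'.eq_or_lt with rfl | hlt
  · exact le_rfl
  have h1 := hF.ironedRevenueCurve_le_supporting_line hu ⟨hu'.1.le, hu'.2.le⟩
  have h2 := hF.ironedRevenueCurve_le_supporting_line hu' ⟨hu.1.le, hu.2.le⟩
  have h3 : 0 < u' - u := sub_pos.2 hlt
  nlinarith

lemma slope_le_quantileVirtualValue (hF : IsValueDistribution F) {u y : ℝ}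
    (hu : u ∈ Ioo (0 : ℝ) 1) (huy : u < y) (hy : y ≤ 1) :
    slope (ironedRevenueCurve F) u y ≤ quantileVirtualValue F u := by
  have := hF.ironedRevenueCurve_le_supporting_line hu ⟨hu.1.le.trans huy.le, hy⟩
  rw [slope_def_field, div_le_iff₀ (by linarith)]
  linarith

lemma quantileVirtualValue_le_slope (hF : IsValueDistribution F) {u y : ℝ}
    (hu : u ∈ Ioo (0 : ℝ) 1) (hyu : y < u) (hy : 0 ≤ y) :
    quantileVirtualValue F u ≤ slope (ironedRevenueCurve F) u y := by
  have := hF.ironedRevenueCurve_le_supporting_line hu ⟨hy, hyu.le.trans hu.2.le⟩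
  rw [slope_def_field, le_div_iff_of_neg (by linarith)]
  linarith

lemma ironedVirtualValue_le_of_lt (hF : IsValueDistribution F) (hz : z ∈ F.support) {u : ℝ}
    (hu : 0 < u) (huz : u < F.real (Ici z)) :
    ironedVirtualValue F z ≤ quantileVirtualValue F u := by
  have hconc := hF.concaveOn_ironedRevenueCurve
  have hq1 : F.real (Ici z) ≤ 1 := measureReal_le_one
  have hu' : u ∈ Ioo (0 : ℝ) 1 := ⟨hu, huz.trans_le hq1⟩
  have hs := hF.slope_le_quantileVirtualValue hu' huz hq1
  rw [slope_comm] at hs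
  by_cases h : ∀ y > z, F (Ico z y) ≠ 0
  · rw [ironedVirtualValue_of_forall h]
    exact (hconc.liminf_slope_left_le hu.le huz hq1).trans (EReal.coe_le_coe_iff.2 hs)
  · rw [ironedVirtualValue_of_not_forall h]
    refine liminf_slope_right_le (real_Ici_lt_one_of_not_forall hz h) fun t hqt ht => ?_
    refine EReal.coe_le_coe_iff.2 (le_trans ?_ hs)
    exact hconc.slope_anti ⟨hu.le.trans huz.le, hq1⟩ ⟨⟨hu.le, hu'.2.le⟩, huz.ne⟩
      ⟨⟨hu.le.trans (huz.trans hqt).le, ht⟩, hqt.ne'⟩ (huz.trans hqt).le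

lemma le_ironedVirtualValue_of_lt (hF : IsValueDistribution F) {u : ℝ}
    (hu1 : u < 1) (huz : F.real (Ici z) < u) :
    (quantileVirtualValue F u : EReal) ≤ ironedVirtualValue F z := by
  have hconc := hF.concaveOn_ironedRevenueCurve
  have hq0 : 0 ≤ F.real (Ici z) := measureReal_nonneg
  have hu' : u ∈ Ioo (0 : ℝ) 1 := ⟨hq0.trans_lt huz, hu1⟩
  have hs := hF.quantileVirtualValue_le_slope hu' huz hq0
  rw [slope_comm] at hs
  by_cases h : ∀ y > z, F (Ico z y) ≠ 0
  · rw [ironedVirtualValue_of_forall h]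
    refine le_liminf_slope_left (real_Ici_pos_of_forall h) fun t ht htq => ?_
    refine EReal.coe_le_coe_iff.2 (hs.trans ?_)
    exact hconc.slope_anti ⟨hq0, huz.le.trans hu1.le⟩
      ⟨⟨ht, htq.le.trans (huz.le.trans hu1.le)⟩, htq.ne⟩
      ⟨⟨hu'.1.le, hu1.le⟩, huz.ne'⟩ (htq.trans huz).le
  · rw [ironedVirtualValue_of_not_forall h]
    exact (EReal.coe_le_coe_iff.2 hs).trans (hconc.le_liminf_slope_right hq0 huz hu1.le)

lemma ironedVirtualValue_monotoneOn (hF : IsValueDistribution F) :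
    MonotoneOn (ironedVirtualValue F) F.support := by
  intro z hz z' hz' hzz'
  rcases hzz'.eq_or_lt with rfl | hlt
  · exact le_rfl
  have hconc := hF.concaveOn_ironedRevenueCurve
  have hq1 : F.real (Ici z) ≤ 1 := measureReal_le_one
  have hq0 : 0 ≤ F.real (Ici z') := measureReal_nonneg
  rcases (real_Ici_anti (F := F) hzz').eq_or_lt with heq | hqq
  · -- no mass between `z` and `z'`: the right derivative at `z`, either one at `z'`
    have h : ¬ ∀ y > z, F (Ico z y) ≠ 0 := by
      push Not
      refine ⟨z', hlt, ?_⟩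
      have := real_Ici_add_Ico (F := F) hzz'
      rw [heq, right_eq_add, measureReal_eq_zero_iff] at this
      exact this
    by_cases h' : ∀ y > z', F (Ico z' y) ≠ 0
    · rw [ironedVirtualValue_of_not_forall h, ironedVirtualValue_of_forall h', heq]
      refine le_liminf_slope_left (heq ▸ real_Ici_pos_of_forall h') fun t ht htq => ?_
      refine liminf_slope_right_le (real_Ici_lt_one_of_not_forall hz h) fun r hqr hr => ?_
      exact EReal.coe_le_coe_iff.2 (hconc.slope_anti ⟨ht.trans htq.le, hq1⟩
        ⟨⟨ht, htq.le.trans hq1⟩, htq.ne⟩ ⟨⟨ht.trans (htq.trans hqr).le, hr⟩, hqr.ne'⟩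
        (htq.trans hqr).le)
    · rw [ironedVirtualValue_of_not_forall h, ironedVirtualValue_of_not_forall h', heq]
  · obtain ⟨u, hu, hu'⟩ := exists_between hqq
    exact (hF.ironedVirtualValue_le_of_lt hz (hq0.trans_lt hu) hu').trans
      (hF.le_ironedVirtualValue_of_lt (hu'.trans_le hq1) hu)

/-- A value with `Pr[v ≥ z] = 0` in the support is its maximum, and the whole revenue curve is
below the line of slope `z` through the origin. -/
lemma ironedVirtualValue_le_self_of_eq_zero (hF : IsValueDistribution F)
    (h0 : F.real (Ici z) = 0) : ironedVirtualValue F z ≤ z := by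
  have h : ¬ ∀ y > z, F (Ico z y) ≠ 0 := fun h => (real_Ici_pos_of_forall h).ne' h0
  rw [ironedVirtualValue_of_not_forall h, h0]
  refine liminf_slope_right_le one_pos fun t ht ht1 => EReal.coe_le_coe_iff.2 ?_
  rw [slope_def_field, hF.ironedRevenueCurve_zero, sub_zero, sub_zero, div_le_iff₀ ht]
  have := hF.ironedRevenueCurve_le_affine' 0 z (fun r hr => ?_) ⟨ht.le, ht1⟩
  · simpa using this
  · rcases hr.1.eq_or_lt with rfl | hr0
    · simp [revenueCurve]
    · have := (hF.quantileValue_lt_iff (y := z) hr0 hr.2).2 (h0 ▸ hr0)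
      rw [revenueCurve]
      nlinarith

lemma ironedVirtualValue_ne_top (hF : IsValueDistribution F) (hz : z ∈ F.support) :
    ironedVirtualValue F z ≠ ⊤ := by
  rcases (measureReal_nonneg : 0 ≤ F.real (Ici z)).eq_or_lt with h | h
  · exact ((hF.ironedVirtualValue_le_self_of_eq_zero h.symm).trans_lt (EReal.coe_lt_top _)).ne
  · exact ((hF.ironedVirtualValue_le_of_lt hz (half_pos h) (half_lt_self h)).trans_lt
      (EReal.coe_lt_top _)).ne

end IsValueDistribution

/-! ### Expected revenue from a single bidder -/

/-- A function has a derivative wherever a selection of its supergradients is continuous. -/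
lemma hasDerivAt_of_supergradient {f g : ℝ → ℝ} {s : Set ℝ} {x : ℝ} (hs : s ∈ 𝓝 x)
    (h : ∀ a ∈ s, ∀ b ∈ s, f b ≤ f a + g a * (b - a)) (hc : ContinuousAt g x) :
    HasDerivAt f (g x) x := by
  rw [hasDerivAt_iff_isLittleO, Asymptotics.isLittleO_iff]
  intro c hc0
  filter_upwards [hs, Metric.continuousAt_iff'.1 hc c hc0] with y hy hyc
  have h1 := h x (mem_of_mem_nhds hs) y hy
  have h2 := h y hy x (mem_of_mem_nhds hs)
  rw [Real.dist_eq] at hyc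
  rw [smul_eq_mul, Real.norm_eq_abs, Real.norm_eq_abs, abs_of_nonpos (by linarith)]
  calc -(f y - f x - (y - x) * g x) ≤ (g x - g y) * (y - x) := by linarith
    _ ≤ |(g x - g y) * (y - x)| := le_abs_self _
    _ = |g y - g x| * |y - x| := by rw [abs_mul, abs_sub_comm]
    _ ≤ c * |y - x| := by gcongr

namespace IsValueDistribution

variable {F : Measure ℝ} [IsProbabilityMeasure F]

lemma aemeasurable_quantileValue (hF : IsValueDistribution F) :
    AEMeasurable (quantileValue F) (volume.restrict (Ioo 0 1)) :=
  aemeasurable_restrict_of_antitoneOn measurableSet_Ioo fun _ hu _ hu' h =>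
    hF.quantileValue_anti hu.1 h hu'.2.le

/-- The value at a uniformly distributed quantile has distribution `F`. -/
lemma map_quantileValue (hF : IsValueDistribution F) :
    (volume.restrict (Ioo (0 : ℝ) 1)).map (quantileValue F) = F := by
  refine (Measure.ext_of_Ici _ _ fun a => ?_).symm
  rw [Measure.map_apply_of_aemeasurable hF.aemeasurable_quantileValue measurableSet_Ici]
  have hq1 : F.real (Ici a) ≤ 1 := measureReal_le_one
  have h : (volume.restrict (Ioo (0 : ℝ) 1)) (quantileValue F ⁻¹' Ici a)
      = (volume.restrict (Ioo (0 : ℝ) 1)) (Iic (F.real (Ici a))) := by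
    refine measure_congr ?_
    filter_upwards [ae_restrict_mem measurableSet_Ioo] with u hu
    exact propext (hF.le_quantileValue_iff hu.1 hu.2.le)
  rw [h, Measure.restrict_congr_set Ioo_ae_eq_Ioc, Measure.restrict_apply measurableSet_Iic,
    inter_comm, Ioc_inter_Iic, min_eq_right hq1, Real.volume_Ioc, sub_zero, measureReal_def,
    ENNReal.ofReal_toReal (measure_ne_top _ _)]

lemma aemeasurable_ironedVirtualValue (hF : IsValueDistribution F) :
    AEMeasurable (ironedVirtualValue F) F := by
  have h := aemeasurable_restrict_of_monotoneOn (μ := F) Measure.isClosed_support.measurableSet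
    hF.ironedVirtualValue_monotoneOn
  rwa [Measure.restrict_eq_self_of_ae_mem
    (show ∀ᵐ z ∂F, z ∈ F.support from Measure.support_mem_ae)] at h

/-- Expectations of functions of the ironed virtual value, in quantile space. -/
lemma lintegral_comp_ironedVirtualValue (hF : IsValueDistribution F) {h : EReal → ENNReal}
    (hh : Measurable h) :
    ∫⁻ z, h (ironedVirtualValue F z) ∂F = ∫⁻ u in Ioo 0 1, h (quantileVirtualValue F u) := by
  have hm : AEMeasurable (fun z => h (ironedVirtualValue F z))
      ((volume.restrict (Ioo (0 : ℝ) 1)).map (quantileValue F)) := by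
    rw [hF.map_quantileValue]
    exact hh.comp_aemeasurable hF.aemeasurable_ironedVirtualValue
  have := lintegral_map' hm hF.aemeasurable_quantileValue
  rw [hF.map_quantileValue] at this
  rw [this]
  refine setLIntegral_congr_fun measurableSet_Ioo fun u hu => ?_
  simp only [hF.coe_quantileVirtualValue hu]

lemma integral_quantileVirtualValue (hF : IsValueDistribution F) {a b : ℝ} (ha : 0 < a)
    (hab : a ≤ b) (hb : b < 1) :
    ∫ u in a..b, quantileVirtualValue F u = ironedRevenueCurve F b - ironedRevenueCurve F a := by
  have hsub : Icc a b ⊆ Ioo 0 1 := Icc_subset_Ioo ha hb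
  refine integral_eq_of_hasDerivAt_off_countable_of_le _ _ hab
    hF.quantileVirtualValue_antitoneOn.countable_not_continuousWithinAt
    (hF.continuousOn_ironedRevenueCurve.mono (hsub.trans Ioo_subset_Icc_self)) ?_ ?_
  · rintro x ⟨hx, hx'⟩
    have hx01 := hsub (Ioo_subset_Icc_self hx)
    have hnhds := Ioo_mem_nhds hx01.1 hx01.2
    refine hasDerivAt_of_supergradient hnhds (fun u hu y hy =>
      hF.ironedRevenueCurve_le_supporting_line hu ⟨hy.1.le, hy.2.le⟩) ?_
    have : ContinuousWithinAt (quantileVirtualValue F) (Ioo 0 1) x := by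
      by_contra hcon
      exact hx' ⟨hx01, hcon⟩
    exact this.continuousAt hnhds
  · exact (hF.quantileVirtualValue_antitoneOn.mono
      ((uIcc_of_le hab).trans_subset hsub)).intervalIntegrable

lemma lintegral_quantileVirtualValue (hF : IsValueDistribution F) {q : ℝ} (hq : 0 < q)
    (hq1 : q ≤ 1) (hnonneg : ∀ u ∈ Ioo 0 q, 0 ≤ quantileVirtualValue F u) :
    ∫⁻ u in Ioo 0 q, ENNReal.ofReal (quantileVirtualValue F u)
      = ENNReal.ofReal (ironedRevenueCurve F q) := by
  have hlim0 : Tendsto (fun ε : ℝ => ε) (𝓝[>] 0) (𝓝 0) := tendsto_id.mono_left nhdsWithin_le_nhds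
  have hlimq : Tendsto (fun ε : ℝ => q - ε) (𝓝[>] 0) (𝓝 q) := by
    simpa using (tendsto_const_nhds (x := q)).sub hlim0
  have hsmall : ∀ᶠ ε in 𝓝[>] (0 : ℝ), ε ∈ Ioo 0 (q / 2) := Ioo_mem_nhdsGT (half_pos hq)
  have hcov := aecover_Ioo_of_Ioc (μ := volume) hlim0 hlimq
  refine hcov.lintegral_eq_of_tendsto _ ?_ ?_
  · refine ENNReal.measurable_ofReal.comp_aemeasurable ?_
    exact aemeasurable_restrict_of_antitoneOn measurableSet_Ioo
      (hF.quantileVirtualValue_antitoneOn.mono (Ioo_subset_Ioo_right hq1))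
  have hint : ∀ᶠ ε in 𝓝[>] (0 : ℝ), ENNReal.ofReal
      (ironedRevenueCurve F (q - ε) - ironedRevenueCurve F ε)
      = ∫⁻ u in Ioc ε (q - ε), ENNReal.ofReal (quantileVirtualValue F u)
          ∂(volume.restrict (Ioo 0 q)) := by
    filter_upwards [hsmall] with ε hε
    have hle : ε ≤ q - ε := by linarith [hε.2]
    have hsub : Ioc ε (q - ε) ⊆ Ioo 0 q := fun u hu =>
      ⟨hε.1.trans hu.1, hu.2.trans_lt (by linarith [hε.1])⟩
    have h1 : q - ε < 1 := by linarith [hε.1]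
    rw [Measure.restrict_restrict measurableSet_Ioc, inter_eq_left.2 hsub,
      ← hF.integral_quantileVirtualValue hε.1 hle h1, intervalIntegral.integral_of_le hle]
    refine ofReal_integral_eq_lintegral_ofReal ?_ ?_
    · refine (intervalIntegrable_iff_integrableOn_Ioc_of_le hle).1 ?_
      refine (hF.quantileVirtualValue_antitoneOn.mono ?_).intervalIntegrable
      rw [uIcc_of_le hle]
      exact Icc_subset_Ioo hε.1 h1
    · filter_upwards [ae_restrict_mem measurableSet_Ioc] with u hu
      exact hnonneg u (hsub hu)
  refine Tendsto.congr' hint (ENNReal.tendsto_ofReal ?_)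
  have hcont := hF.continuousOn_ironedRevenueCurve
  have t1 : Tendsto (fun ε : ℝ => ironedRevenueCurve F (q - ε)) (𝓝[>] 0)
      (𝓝 (ironedRevenueCurve F q)) := by
    refine (hcont q ⟨hq.le, hq1⟩).tendsto.comp (tendsto_nhdsWithin_iff.2 ⟨hlimq, ?_⟩)
    filter_upwards [hsmall] with ε hε
    exact ⟨by linarith [hε.2], by linarith [hε.1]⟩
  have t2 : Tendsto (fun ε : ℝ => ironedRevenueCurve F ε) (𝓝[>] 0)
      (𝓝 (ironedRevenueCurve F 0)) := by
    refine (hcont 0 (by simp)).tendsto.comp (tendsto_nhdsWithin_iff.2 ⟨hlim0, ?_⟩)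
    filter_upwards [hsmall] with ε hε
    exact ⟨hε.1.le, by linarith [hε.2]⟩
  simpa [hF.ironedRevenueCurve_zero] using t1.sub t2

/-- `W` is a set of virtual values closed under increase and without negative members: the
virtual values with which a bidder wins against fixed bids of the others. -/
structure _root_.IsWinningSet (W : Set EReal) : Prop where
  nonneg : ∀ x ∈ W, 0 ≤ x
  up : ∀ x y : ℝ, (x : EReal) ∈ W → x ≤ y → (y : EReal) ∈ W

/-- The winning quantiles form an interval with left end `0`. -/
lemma exists_threshold_quantile (hF : IsValueDistribution F) {W : Set EReal}
    (hW : IsWinningSet W) :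
    ∃ q ∈ Icc (0 : ℝ) 1, (∀ u ∈ Ioo 0 q, (quantileVirtualValue F u : EReal) ∈ W) ∧
      ∀ u ∈ Ioo q 1, (quantileVirtualValue F u : EReal) ∉ W := by
  set U := {u ∈ Ioo (0 : ℝ) 1 | (quantileVirtualValue F u : EReal) ∈ W} with hU
  have hbdd : BddAbove U := ⟨1, fun u hu => hu.1.2.le⟩
  have hq1 : sSup U ≤ 1 := Real.sSup_le (fun u hu => hu.1.2.le) zero_le_one
  have hq0 : 0 ≤ sSup U := Real.sSup_nonneg fun u hu => hu.1.1.le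
  refine ⟨sSup U, ⟨hq0, hq1⟩, fun u hu => ?_, fun u hu h => ?_⟩
  · have hne : U.Nonempty := by
      by_contra hcon
      rw [not_nonempty_iff_eq_empty.1 hcon, Real.sSup_empty] at hu
      exact absurd (hu.1.trans hu.2) (lt_irrefl _)
    obtain ⟨u', hu', huu'⟩ := exists_lt_of_lt_csSup hne hu.2
    exact hW.up _ _ hu'.2 (hF.quantileVirtualValue_antitoneOn ⟨hu.1, hu.2.trans_le hq1⟩ hu'.1
      huu'.le)
  · exact absurd (le_csSup hbdd ⟨⟨hq0.trans_lt hu.1, hu.2⟩, h⟩) (not_le.2 hu.1)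

lemma quantileVirtualValue_eq_slope (hF : IsValueDistribution F) {a b u : ℝ} (ha : 0 ≤ a)
    (hb : b ≤ 1) (hu : u ∈ Ioo a b)
    (h : ∀ t, a ≤ t → t ≤ b → revenueCurve F t
      ≤ ironedRevenueCurve F a + slope (ironedRevenueCurve F) a b * (t - a)) :
    quantileVirtualValue F u = slope (ironedRevenueCurve F) a b := by
  have hab := hu.1.trans hu.2
  have hu' : u ∈ Ioo (0 : ℝ) 1 := ⟨ha.trans_lt hu.1, hu.2.trans_le hb⟩
  have h1 := hF.ironedRevenueCurve_le_chord ha hab hb h ⟨hu'.1.le, hu'.2.le⟩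
  have ea := hF.ironedRevenueCurve_le_supporting_line hu' ⟨ha, hab.le.trans hb⟩
  have eb := hF.ironedRevenueCurve_le_supporting_line hu' ⟨ha.trans hab.le, hb⟩
  have e : ironedRevenueCurve F b
      = ironedRevenueCurve F a + slope (ironedRevenueCurve F) a b * (b - a) := by
    rw [slope_def_field, div_mul_cancel₀ _ (sub_pos.2 hab).ne']
    ring
  have hua := sub_pos.2 hu.1
  have hub := sub_pos.2 hu.2
  apply le_antisymm
  · have : quantileVirtualValue F u * (u - a) ≤ slope (ironedRevenueCurve F) a b * (u - a) := by
      linarith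
    exact le_of_mul_le_mul_right this hua
  · have : slope (ironedRevenueCurve F) a b * (b - u) ≤ quantileVirtualValue F u * (b - u) := by
      linarith
    exact le_of_mul_le_mul_right this hub

/-- The threshold is not inside an ironed interval, so the curve meets its hull there. -/
lemma ironedRevenueCurve_threshold_le (hF : IsValueDistribution F) {W : Set EReal} {q : ℝ}
    (hq : 0 < q) (hq1 : q ≤ 1) (hin : ∀ u ∈ Ioo 0 q, (quantileVirtualValue F u : EReal) ∈ W)
    (hout : ∀ u ∈ Ioo q 1, (quantileVirtualValue F u : EReal) ∉ W) :
    ironedRevenueCurve F q ≤ revenueCurve F q := by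
  rcases hq1.eq_or_lt with rfl | hq1'
  · exact hF.ironedRevenueCurve_one.le
  by_contra! hlt
  obtain ⟨c, hc, hc'⟩ := exists_between hlt
  obtain ⟨a, b, ha, haq, hqb, hab⟩ := hF.exists_revenueCurve_lt hq hq1 hc
  have hcont : ContinuousAt (ironedRevenueCurve F) q :=
    (hF.continuousOn_ironedRevenueCurve q ⟨hq.le, hq1⟩).continuousAt (Icc_mem_nhds hq hq1')
  obtain ⟨l, r, hlr, hsub⟩ := mem_nhds_iff_exists_Ioo_subset.1 (hcont.eventually_const_lt hc')
  obtain ⟨a', ha', haq'⟩ := exists_between (max_lt haq hlr.1)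
  obtain ⟨b', hqb', hb'⟩ := exists_between (lt_min (lt_min hqb hlr.2) hq1')
  obtain ⟨ha1, ha2⟩ := max_lt_iff.1 ha'
  obtain ⟨hb0, hb3⟩ := lt_min_iff.1 hb'
  obtain ⟨hb1, hb2⟩ := lt_min_iff.1 hb0
  have hab' : a' < b' := haq'.trans hqb'
  have hfa : c < ironedRevenueCurve F a' := hsub ⟨ha2, haq'.trans hlr.2⟩
  have hfb : c < ironedRevenueCurve F b' := hsub ⟨hlr.1.trans hqb', hb2⟩
  have hba : 0 < b' - a' := sub_pos.2 hab'
  have hchord : ∀ t, a' ≤ t → t ≤ b' → revenueCurve F t ≤ ironedRevenueCurve F a'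
      + slope (ironedRevenueCurve F) a' b' * (t - a') := by
    intro t hat htb
    refine (hab t (ha1.le.trans hat) (htb.trans hb1.le) (htb.trans hb3.le)).le.trans ?_
    rw [slope_def_field, div_mul_eq_mul_div, ← sub_le_iff_le_add', le_div_iff₀ hba]
    nlinarith [mul_nonneg (sub_nonneg.2 hat) (sub_nonneg.2 hfb.le),
      mul_nonneg (sub_nonneg.2 htb) (sub_nonneg.2 hfa.le)]
  have ha0 : 0 < a' := ha.trans ha1
  obtain ⟨u, hu, hu'⟩ := exists_between haq'
  obtain ⟨w, hw, hw'⟩ := exists_between hqb'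
  have e1 := hF.quantileVirtualValue_eq_slope ha0.le hb3.le ⟨hu, hu'.trans hqb'⟩ hchord
  have e2 := hF.quantileVirtualValue_eq_slope ha0.le hb3.le ⟨haq'.trans hw, hw'⟩ hchord
  refine hout w ⟨hw, hw'.trans hb3⟩ ?_
  rw [e2, ← e1]
  exact hin u ⟨ha0.trans hu, hu'⟩

/-- Every winning value of the support is at least the value at the threshold. If the support has a
gap below that value then the revenue curve drops at the threshold, hence it is ironed on the right
of it, and the value `z` at the lower end of the gap is not winning either. -/
lemma quantileValue_threshold_le (hF : IsValueDistribution F) {W : Set EReal}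
    (hW : IsWinningSet W) {q : ℝ} (hq : 0 < q) (hq1 : q ≤ 1)
    (hout : ∀ u ∈ Ioo q 1, (quantileVirtualValue F u : EReal) ∉ W) {z : ℝ} (hz : z ∈ F.support)
    (hzW : ironedVirtualValue F z ∈ W) : quantileValue F q ≤ z := by
  by_contra! hlt
  have hqz := (hF.le_quantileValue_iff hq hq1).1 hlt.le
  have hz1 : F.real (Ici z) ≤ 1 := measureReal_le_one
  have hbot : ironedVirtualValue F z ≠ ⊥ := fun h => by
    simpa [h] using hW.nonneg _ hzW
  have hcoe := EReal.coe_toReal (hF.ironedVirtualValue_ne_top hz) hbot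
  rw [← hcoe] at hzW
  suffices ∃ u ∈ Ioo q 1, ironedVirtualValue F z ≤ quantileVirtualValue F u by
    obtain ⟨u, hu, hle⟩ := this
    rw [← hcoe, EReal.coe_le_coe_iff] at hle
    exact hout u hu (hW.up _ _ hzW hle)
  rcases hqz.eq_or_lt with heq | hqlt
  · have hgap : ¬ ∀ y > z, F (Ico z y) ≠ 0 := by
      push Not
      refine ⟨_, hlt, ?_⟩
      have h1 := real_Ici_add_Ico (F := F) hlt.le
      have h2 := hF.le_real_Ici_quantileValue hq hq1
      have h3 : 0 ≤ F.real (Ico z (quantileValue F q)) := measureReal_nonneg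
      rw [← measureReal_eq_zero_iff]
      linarith
    have hq1' : q < 1 := heq ▸ real_Ici_lt_one_of_not_forall hz hgap
    have hfq : q * z < ironedRevenueCurve F q :=
      lt_of_lt_of_le (by rw [revenueCurve]; gcongr)
        (hF.revenueCurve_le_ironed (q := q) ⟨hq.le, hq1⟩)
    have hcont : ContinuousAt (ironedRevenueCurve F) q :=
      (hF.continuousOn_ironedRevenueCurve q ⟨hq.le, hq1⟩).continuousAt (Icc_mem_nhds hq hq1')
    have hev : ∀ᶠ t in 𝓝 q, t * z < ironedRevenueCurve F t :=
      (continuousAt_id.mul continuousAt_const).eventually_lt hcont hfq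
    obtain ⟨r, hr, hsub⟩ := mem_nhdsGT_iff_exists_Ioo_subset.1
      (hev.filter_mono (nhdsWithin_le_nhds (s := Ioi q)))
    obtain ⟨b, hqb, hb⟩ := exists_between (lt_min (show q < r from hr) hq1')
    obtain ⟨hbr, hb1⟩ := lt_min_iff.1 hb
    have hfb : b * z < ironedRevenueCurve F b := hsub ⟨hqb, hbr⟩
    have hchord : ∀ t, q ≤ t → t ≤ b → revenueCurve F t ≤ ironedRevenueCurve F q
        + slope (ironedRevenueCurve F) q b * (t - q) := by
      intro t hqt htb
      rcases hqt.eq_or_lt with rfl | hqt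
      · simpa using hF.revenueCurve_le_ironed (q := q) ⟨hq.le, hq1⟩
      · refine le_trans ?_ (mul_le_chord hqb hfq.le hfb.le hqt.le htb)
        have := (hF.quantileValue_lt_iff (y := z) (hq.trans hqt) (htb.trans hb1.le)).2
          (heq ▸ hqt)
        have ht0 := hq.trans hqt
        rw [revenueCurve]
        gcongr
    obtain ⟨u, hu, hu'⟩ := exists_between hqb
    refine ⟨u, ⟨hu, hu'.trans hb1⟩, ?_⟩
    rw [hF.quantileVirtualValue_eq_slope hq.le hb1.le ⟨hu, hu'⟩ hchord,
      ironedVirtualValue_of_not_forall hgap, ← heq]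
    refine liminf_slope_right_le hq1' fun t hqt ht => EReal.coe_le_coe_iff.2 ?_
    have := hF.ironedRevenueCurve_le_chord hq.le hqb hb1.le hchord
      (y := t) ⟨hq.le.trans hqt.le, ht⟩
    rw [slope_def_field _ q t, div_le_iff₀ (by linarith)]
    linarith
  · obtain ⟨u, hu, hu'⟩ := exists_between hqlt
    exact ⟨u, ⟨hu, hu'.trans_le hz1⟩, hF.ironedVirtualValue_le_of_lt hz (hq.trans hu) hu'⟩

lemma quantileValue_mem_winning (hF : IsValueDistribution F) {W : Set EReal} {q u : ℝ}
    (hq1 : q ≤ 1) (hin : ∀ u ∈ Ioo 0 q, (quantileVirtualValue F u : EReal) ∈ W)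
    (hu : u ∈ Ioo 0 q) :
    quantileValue F u ∈ {z | z ∈ F.support ∧ ironedVirtualValue F z ∈ W} := by
  refine ⟨hF.quantileValue_mem_support hu.1 (hu.2.le.trans hq1), ?_⟩
  rw [hF.coe_quantileVirtualValue ⟨hu.1, hu.2.trans_le hq1⟩]
  exact hin u hu

/-- The critical bid is the value at the threshold, and the revenue it raises is that of the
hull. -/
lemma critical_bid_mul_threshold (hF : IsValueDistribution F) {W : Set EReal}
    (hW : IsWinningSet W) {q : ℝ} (hq : 0 < q) (hq1 : q ≤ 1)
    (hin : ∀ u ∈ Ioo 0 q, (quantileVirtualValue F u : EReal) ∈ W)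
    (hout : ∀ u ∈ Ioo q 1, (quantileVirtualValue F u : EReal) ∉ W) :
    sInf {z | z ∈ F.support ∧ ironedVirtualValue F z ∈ W} * q = ironedRevenueCurve F q := by
  have hbdd : BddBelow {z | z ∈ F.support ∧ ironedVirtualValue F z ∈ W} :=
    ⟨0, fun z hz => hF.nonneg_of_mem_support hz.1⟩
  have hp : sInf {z | z ∈ F.support ∧ ironedVirtualValue F z ∈ W} = quantileValue F q := by
    apply le_antisymm
    · rw [hF.le_quantileValue_iff hq hq1]
      refine le_of_forall_lt_imp_le_of_dense fun u hu => ?_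
      rcases le_or_gt u 0 with h0 | h0
      · exact h0.trans measureReal_nonneg
      · rw [← hF.le_quantileValue_iff h0 (hu.le.trans hq1)]
        exact csInf_le hbdd (hF.quantileValue_mem_winning hq1 hin ⟨h0, hu⟩)
    · exact le_csInf ⟨_, hF.quantileValue_mem_winning hq1 hin ⟨half_pos hq, half_lt_self hq⟩⟩
        fun z hz => hF.quantileValue_threshold_le hW hq hq1 hout hz.1 hz.2
  rw [hp, mul_comm]
  exact le_antisymm (hF.revenueCurve_le_ironed ⟨hq.le, hq1⟩)
    (hF.ironedRevenueCurve_threshold_le hq hq1 hin hout)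

lemma lintegral_winning (hF : IsValueDistribution F) {W : Set EReal} (hWm : MeasurableSet W)
    {q : ℝ} (hq1 : q ≤ 1)
    (hin : ∀ u ∈ Ioo 0 q, (quantileVirtualValue F u : EReal) ∈ W)
    (hout : ∀ u ∈ Ioo q 1, (quantileVirtualValue F u : EReal) ∉ W) {h : EReal → ENNReal}
    (hh : Measurable h) :
    ∫⁻ z, W.indicator h (ironedVirtualValue F z) ∂F
      = ∫⁻ u in Ioo 0 q, h (quantileVirtualValue F u) := by
  rw [hF.lintegral_comp_ironedVirtualValue (hh.indicator hWm)]
  have hsub : Ioo 0 q ⊆ Ioo (0 : ℝ) 1 := Ioo_subset_Ioo_right hq1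
  have h1 : ∀ᵐ u ∂(volume.restrict (Ioo (0 : ℝ) 1)),
      W.indicator h (quantileVirtualValue F u : EReal)
        = (Ioo 0 q).indicator (fun u => h (quantileVirtualValue F u)) u := by
    have hne : ∀ᵐ u ∂(volume.restrict (Ioo (0 : ℝ) 1)), u ≠ q :=
      ae_restrict_of_ae (Measure.ae_ne volume q)
    filter_upwards [ae_restrict_mem measurableSet_Ioo, hne] with u hu huq
    rcases lt_or_gt_of_ne huq with hlt | hgt
    · rw [indicator_of_mem (hin u ⟨hu.1, hlt⟩),
        indicator_of_mem (show u ∈ Ioo 0 q from ⟨hu.1, hlt⟩)]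
    · rw [indicator_of_notMem (hout u ⟨hgt, hu.2⟩),
        indicator_of_notMem (fun h => absurd h.2 (not_lt.2 hgt.le))]
  rw [lintegral_congr_ae h1, lintegral_indicator measurableSet_Ioo,
    Measure.restrict_restrict measurableSet_Ioo, inter_eq_left.2 hsub]

/-- **Myerson's lemma** for one bidder and a set `W` of winning ironed virtual values: the expected
payment, the critical bid times the probability of winning, is the expected ironed virtual value
of the winner. -/
lemma critical_bid_mul_prob (hF : IsValueDistribution F) {W : Set EReal} (hW : IsWinningSet W)
    (hWm : MeasurableSet W) :
    ENNReal.ofReal (sInf {z | z ∈ F.support ∧ ironedVirtualValue F z ∈ W})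
        * ∫⁻ z, W.indicator 1 (ironedVirtualValue F z) ∂F
      = ∫⁻ z, W.indicator EReal.toENNReal (ironedVirtualValue F z) ∂F := by
  obtain ⟨q, ⟨hq, hq1⟩, hin, hout⟩ := hF.exists_threshold_quantile hW
  rw [hF.lintegral_winning hWm hq1 hin hout measurable_one,
    hF.lintegral_winning hWm hq1 hin hout measurable_ereal_toENNReal]
  rcases hq.eq_or_lt with rfl | hq0
  · simp
  have hp0 : 0 ≤ sInf {z | z ∈ F.support ∧ ironedVirtualValue F z ∈ W} :=
    Real.sInf_nonneg fun z hz => hF.nonneg_of_mem_support hz.1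
  have e := hF.lintegral_quantileVirtualValue hq0 hq1 fun u hu => by
    exact_mod_cast hW.nonneg _ (hin u hu)
  simp only [Pi.one_apply, lintegral_one, Measure.restrict_apply_univ, Real.volume_Ioo, sub_zero,
    EReal.toENNReal_of_ne_top (EReal.coe_ne_top _), EReal.toReal_coe]
  rw [e, ← ENNReal.ofReal_mul hp0, hF.critical_bid_mul_threshold hW hq0 hq1 hin hout]

/-- Non-negative ironed virtual values are at most the value: apply Myerson's lemma to the set of
all virtual values from that of `z` on, so that the critical bid is at most `z`. -/
lemma ironedVirtualValue_le_self (hF : IsValueDistribution F) {z : ℝ} (hz : z ∈ F.support)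
    (h0 : 0 ≤ ironedVirtualValue F z) : ironedVirtualValue F z ≤ z := by
  rcases (measureReal_nonneg : 0 ≤ F.real (Ici z)).eq_or_lt with hr | hr
  · exact hF.ironedVirtualValue_le_self_of_eq_zero hr.symm
  have hcoe := EReal.coe_toReal (hF.ironedVirtualValue_ne_top hz)
    (fun h => by simp [h] at h0)
  set x := (ironedVirtualValue F z).toReal with hx
  have hW : IsWinningSet (Ici (ironedVirtualValue F z)) :=
    ⟨fun y hy => h0.trans hy, fun x y hx hxy => le_trans hx (EReal.coe_le_coe_iff.2 hxy)⟩
  obtain ⟨q, ⟨hq, hq1⟩, hin, hout⟩ := hF.exists_threshold_quantile hW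
  have hz1 : F.real (Ici z) ≤ 1 := measureReal_le_one
  have hq0 : 0 < q := by
    by_contra! h
    have hu := half_lt_self hr
    exact hout _ ⟨h.trans_lt (half_pos hr), hu.trans_le hz1⟩
      (hF.ironedVirtualValue_le_of_lt hz (half_pos hr) hu)
  have hp := hF.critical_bid_mul_threshold hW hq0 hq1 hin hout
  have hpz : sInf {y | y ∈ F.support ∧ ironedVirtualValue F y ∈ Ici (ironedVirtualValue F z)}
      ≤ z := csInf_le ⟨0, fun y hy => hF.nonneg_of_mem_support hy.1⟩ ⟨hz, self_mem_Ici⟩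
  -- the hull is above the line of slope `x` through the origin up to the threshold
  have hline : ∀ u ∈ Ioo 0 q, x * u ≤ ironedRevenueCurve F u := fun u hu => by
    have h1 := hF.ironedRevenueCurve_le_supporting_line (y := 0) ⟨hu.1, hu.2.trans_le hq1⟩
      (by simp)
    have h2 : x ≤ quantileVirtualValue F u := by
      have := hin u hu
      rwa [← hcoe, mem_Ici, EReal.coe_le_coe_iff] at this
    rw [hF.ironedRevenueCurve_zero] at h1
    have := mul_le_mul_of_nonneg_right h2 hu.1.le
    linarith
  have hxq : x * q ≤ ironedRevenueCurve F q := by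
    have hsub : Ioo 0 q ⊆ Icc (0 : ℝ) 1 := (Ioo_subset_Icc_self).trans (Icc_subset_Icc_right hq1)
    have hc := ((hF.continuousOn_ironedRevenueCurve q ⟨hq, hq1⟩).mono hsub).tendsto
    have hne : (𝓝[Ioo 0 q] q).NeBot := by
      rw [← mem_closure_iff_nhdsWithin_neBot, closure_Ioo hq0.ne]
      exact right_mem_Icc.2 hq
    refine le_of_tendsto_of_tendsto
      ((continuous_const.mul continuous_id).continuousWithinAt (s := Ioo 0 q) (x := q)).tendsto
      hc ?_
    filter_upwards [self_mem_nhdsWithin] with u hu using hline u hu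
  rw [← hp] at hxq
  rw [← hcoe, EReal.coe_le_coe_iff]
  exact (le_of_mul_le_mul_right hxq hq0).trans hpz

end IsValueDistribution

/-! ### Expected revenue with several bidders -/

section Product

variable {κ : Type*} (F : κ → Measure ℝ)

/-- The vector of ironed virtual values of a vector of bids. -/
noncomputable def virtualValues (b : κ → ℝ) : κ → EReal := fun j => ironedVirtualValue (F j) (b j)

open Classical in
/-- The payment of bidder `i` if she wins whenever the vector of ironed virtual values is in
`Win`. -/
noncomputable def criticalPayment (Win : Set (κ → EReal)) (i : κ) (b : κ → ℝ) : ℝ :=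
  if virtualValues F b ∈ Win then
    sInf {z | z ∈ (F i).support ∧ virtualValues F (Function.update b i z) ∈ Win}
  else 0

/-- The ironed virtual value of bidder `i` if she wins, and `0` otherwise. -/
noncomputable def virtualSurplus (Win : Set (κ → EReal)) (i : κ) (b : κ → ℝ) : ENNReal :=
  Win.indicator (fun φ => (φ i).toENNReal) (virtualValues F b)

open Classical in
/-- `Win` is a measurable set of vectors of virtual values, and its sections in the direction `i`
are winning sets. -/
structure IsWinningRegion (Win : Set (κ → EReal)) (i : κ) : Prop where
  measurableSet : MeasurableSet Win
  isWinningSet : ∀ φ : κ → EReal, IsWinningSet {y | Function.update φ i y ∈ Win}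

variable {F}

lemma criticalPayment_nonneg (hF : ∀ i, IsValueDistribution (F i)) (Win : Set (κ → EReal)) (i : κ)
    (b : κ → ℝ) : 0 ≤ criticalPayment F Win i b := by
  rw [criticalPayment]
  split_ifs
  · exact Real.sInf_nonneg fun z hz => (hF i).nonneg_of_mem_support hz.1
  · exact le_rfl

variable [∀ i, IsProbabilityMeasure (F i)]

lemma exists_measurable_eqOn_virtualValues (hF : ∀ i, IsValueDistribution (F i)) :
    ∃ ψ : κ → ℝ → EReal, (∀ i, Measurable (ψ i)) ∧
      ∀ i, EqOn (ironedVirtualValue (F i)) (ψ i) (F i).support := by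
  have h := fun i => (hF i).ironedVirtualValue_monotoneOn.exists_monotone_extension
    (OrderBot.bddBelow _) (OrderTop.bddAbove _)
  choose ψ hψ hψ' using h
  exact ⟨ψ, fun i => (hψ i).measurable, hψ'⟩

variable [Fintype κ]

lemma ae_mem_support : ∀ᵐ b ∂(Measure.pi F), ∀ i, b i ∈ (F i).support := by
  refine eventually_all.2 fun i => ?_
  exact (measurePreserving_eval F i).quasiMeasurePreserving.ae
    (show ∀ᵐ z ∂(F i), z ∈ (F i).support from Measure.support_mem_ae)

open Classical in
/-- **Myerson's lemma**: the expected payment of a bidder is her expected virtual surplus.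

Fix the other bids; let `N` and `D` be the expected virtual surplus of bidder `i` and the
probability that she wins. Her payment is `N / D` whenever she wins, up to null events, by the
lemma for one bidder. This quotient is a measurable function of the other bids, although the
critical bid is an infimum over an uncountable set. -/
theorem lintegral_criticalPayment (hF : ∀ i, IsValueDistribution (F i)) {Win : Set (κ → EReal)}
    {i : κ} (hWin : IsWinningRegion Win i) :
    AEMeasurable (fun b => ENNReal.ofReal (criticalPayment F Win i b)) (Measure.pi F) ∧
      AEMeasurable (virtualSurplus F Win i) (Measure.pi F) ∧
      ∫⁻ b, ENNReal.ofReal (criticalPayment F Win i b) ∂(Measure.pi F)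
        = ∫⁻ b, virtualSurplus F Win i b ∂(Measure.pi F) := by
  obtain ⟨ψ, hψ, hψF⟩ := exists_measurable_eqOn_virtualValues hF
  set Φ : (κ → ℝ) → κ → EReal := fun b j => ψ j (b j) with hΦ
  have hΦm : Measurable Φ := measurable_pi_lambda _ fun j => (hψ j).comp (measurable_pi_apply j)
  have hΦF : ∀ b, (∀ j, b j ∈ (F j).support) → virtualValues F b = Φ b := fun b hb =>
    funext fun j => hψF j (hb j)
  have hΦu : ∀ b z, Φ (Function.update b i z) = Function.update (Φ b) i (ψ i z) := fun b z =>
    funext fun j => by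
      by_cases hj : j = i
      · subst hj; simp [hΦ]
      · simp [hΦ, hj]
  set g : (κ → ℝ) → ENNReal := fun b => Win.indicator (fun φ => (φ i).toENNReal) (Φ b) with hg
  set h : (κ → ℝ) → ENNReal := fun b => Win.indicator 1 (Φ b) with hh
  have hgm : Measurable g :=
    ((measurable_ereal_toENNReal.comp (measurable_pi_apply i)).indicator
      hWin.measurableSet).comp hΦm
  have hhm : Measurable h := (measurable_one.indicator hWin.measurableSet).comp hΦm
  set N := ∫⋯∫⁻_{i}, g ∂F with hN
  set D := ∫⋯∫⁻_{i}, h ∂F with hD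
  have hNm : Measurable N := hgm.lmarginal F
  have hDm : Measurable D := hhm.lmarginal F
  have hNu : ∀ b z, N (Function.update b i z) = N b := fun b z =>
    lmarginal_update_of_mem F (Finset.mem_singleton_self i) _ _ _
  have hDu : ∀ b z, D (Function.update b i z) = D b := fun b z =>
    lmarginal_update_of_mem F (Finset.mem_singleton_self i) _ _ _
  have hNz : ∀ b, N b = ∫⁻ z, g (Function.update b i z) ∂(F i) := fun b => by
    rw [hN, lmarginal_singleton]
  have hDz : ∀ b, D b = ∫⁻ z, h (Function.update b i z) ∂(F i) := fun b => by
    rw [hD, lmarginal_singleton]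
  have hhle : ∀ b, h b ≤ 1 := fun b => indicator_le_self' (fun _ _ => zero_le_one) _
  have hDtop : ∀ b, D b ≠ ⊤ := fun b => by
    refine ne_top_of_le_ne_top ENNReal.one_ne_top ?_
    rw [hDz]
    calc ∫⁻ z, h (Function.update b i z) ∂(F i) ≤ ∫⁻ _, 1 ∂(F i) := lintegral_mono fun z => hhle _
      _ = 1 := by simp
  have hmu : ∀ b, Measurable fun z => h (Function.update b i z) := fun b =>
    hhm.comp (measurable_update b)
  -- the formula `payment = N / D`
  have hf : ∫⋯∫⁻_{i}, (fun b => h b * (N b / D b)) ∂F = ∫⋯∫⁻_{i}, g ∂F := by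
    funext b
    rw [lmarginal_singleton]
    simp only [hNu, hDu]
    rw [lintegral_mul_const _ (hmu b), ← hDz]
    change _ = N b
    rcases eq_or_ne (D b) 0 with h0 | h0
    · have : N b = 0 := by
        rw [hDz, lintegral_eq_zero_iff (hmu b)] at h0
        rw [hNz]
        refine (lintegral_congr_ae ?_).trans lintegral_zero
        filter_upwards [h0] with z hz
        refine indicator_of_notMem (fun hmem => ?_) _
        rw [Pi.zero_apply, hh] at hz
        simp only [indicator_of_mem hmem, Pi.one_apply, one_ne_zero] at hz
      rw [h0, this, zero_mul]
    · exact ENNReal.mul_div_cancel h0 (hDtop b)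
  -- almost surely, a bidder who wins has a positive probability to do so
  have hpos : ∀ᵐ b ∂(Measure.pi F), Φ b ∈ Win → D b ≠ 0 := by
    have hkm : Measurable fun b => h b * (D ⁻¹' {0}).indicator 1 b :=
      hhm.mul (measurable_one.indicator (hDm (measurableSet_singleton 0)))
    have hk : ∫⁻ b, h b * (D ⁻¹' {0}).indicator 1 b ∂(Measure.pi F) = 0 := by
      rw [lintegral_eq_of_lmarginal_eq (μ := F) {i} hkm (g := fun _ => 0) measurable_const ?_]
      · simp
      funext b
      rw [lmarginal_singleton, lmarginal_singleton]
      have : ∀ z, (D ⁻¹' {0}).indicator (1 : (κ → ℝ) → ENNReal) (Function.update b i z)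
          = (D ⁻¹' {0}).indicator 1 b := fun z => by
        simp only [indicator, mem_preimage, hDu, Pi.one_apply]
      simp only [this]
      rw [lintegral_mul_const _ (hmu b), ← hDz]
      by_cases h0 : D b = 0
      · simp [h0]
      · simp [h0]
    rw [lintegral_eq_zero_iff hkm] at hk
    filter_upwards [hk] with b hb hmem h0
    have h1 : h b = 1 := indicator_of_mem hmem _
    simp [h1, h0] at hb
  have hpay : (fun b => ENNReal.ofReal (criticalPayment F Win i b))
      =ᵐ[Measure.pi F] fun b => h b * (N b / D b) := by
    filter_upwards [ae_mem_support, hpos] with b hb hD0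
    have hset : {z | z ∈ (F i).support ∧ virtualValues F (Function.update b i z) ∈ Win}
        = {z | z ∈ (F i).support ∧ ironedVirtualValue (F i) z
            ∈ {y | Function.update (Φ b) i y ∈ Win}} := by
      ext z
      refine and_congr_right fun hz => ?_
      rw [hΦF, hΦu, mem_ofPred_eq, hψF i hz]
      intro j
      by_cases hj : j = i
      · subst hj; simpa using hz
      · simpa [hj] using hb j
    rw [criticalPayment, hΦF b hb]
    by_cases hmem : Φ b ∈ Win
    · have hW := hWin.isWinningSet (Φ b)
      have hWm : MeasurableSet {y | Function.update (Φ b) i y ∈ Win} :=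
        (measurable_update (Φ b)) hWin.measurableSet
      have key := (hF i).critical_bid_mul_prob hW hWm
      have e1 : ∫⁻ z, {y | Function.update (Φ b) i y ∈ Win}.indicator 1
          (ironedVirtualValue (F i) z) ∂(F i) = D b := by
        rw [hDz]
        refine lintegral_congr_ae ?_
        filter_upwards [show ∀ᵐ z ∂(F i), z ∈ (F i).support from Measure.support_mem_ae]
          with z hz
        rw [hh, hψF i hz]
        simp only [hΦu, indicator, mem_ofPred_eq, Pi.one_apply]
      have e2 : ∫⁻ z, {y | Function.update (Φ b) i y ∈ Win}.indicator EReal.toENNReal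
          (ironedVirtualValue (F i) z) ∂(F i) = N b := by
        rw [hNz]
        refine lintegral_congr_ae ?_
        filter_upwards [show ∀ᵐ z ∂(F i), z ∈ (F i).support from Measure.support_mem_ae]
          with z hz
        rw [hg, hψF i hz]
        simp only [hΦu, indicator, mem_ofPred_eq, Function.update_self]
      rw [e1, e2] at key
      have h1 : h b = 1 := indicator_of_mem hmem _
      rw [if_pos hmem, hset, h1, one_mul, ENNReal.eq_div_iff (hD0 hmem) (hDtop b), mul_comm]
      exact key
    · have h0 : h b = 0 := indicator_of_notMem hmem _
      rw [if_neg hmem, h0, zero_mul, ENNReal.ofReal_zero]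
  have hsur : virtualSurplus F Win i =ᵐ[Measure.pi F] g := by
    filter_upwards [ae_mem_support] with b hb
    rw [virtualSurplus, hΦF b hb]
  have hfm : Measurable fun b => h b * (N b / D b) := hhm.mul (hNm.div hDm)
  refine ⟨⟨_, hfm, hpay⟩, ⟨g, hgm, hsur⟩, ?_⟩
  rw [lintegral_congr_ae hpay, lintegral_congr_ae hsur]
  exact lintegral_eq_of_lmarginal_eq {i} hfm hgm hf

end Product

/-! ### The mechanism with fixed red bids -/

section Markets

variable {ι : Type*} {G : Finset ι}

open Classical in
/-- The vector of virtual values obtained by interleaving those of the bidders in `G` and those of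
the other bidders. -/
noncomputable def joinValues (G : Finset ι) (x : {i // i ∈ G} → EReal) (y : {i // i ∉ G} → EReal) :
    ι → EReal :=
  fun i => if h : i ∈ G then x ⟨i, h⟩ else y ⟨i, h⟩

lemma virtualValues_joinBids (F : ι → Measure ℝ) (b : {i // i ∈ G} → ℝ) (bR : {i // i ∉ G} → ℝ) :
    virtualValues F (joinBids G b bR)
      = joinValues G (virtualValues (fun i : {i // i ∈ G} => F i) b)
          (virtualValues (fun i : {i // i ∉ G} => F i) bR) := by
  funext i
  by_cases h : i ∈ G <;> simp [virtualValues, joinBids, joinValues, h]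

lemma measurable_joinValues (y : {i // i ∉ G} → EReal) :
    Measurable fun x => joinValues G x y := by
  refine measurable_pi_lambda _ fun i => ?_
  by_cases h : i ∈ G
  · simp only [joinValues, h, dite_true]
    exact measurable_pi_apply _
  · simp only [joinValues, h, dite_false]
    exact measurable_const

lemma joinValues_update [DecidableEq ι] [DecidableEq {i // i ∈ G}]
    (x : {i // i ∈ G} → EReal) (y : {i // i ∉ G} → EReal) (i : {i // i ∈ G})
    (a : EReal) :
    joinValues G (Function.update x i a) y = Function.update (joinValues G x y) i a := by
  funext j
  by_cases hj : j = i
  · subst hj; simp [joinValues]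
  · by_cases h : j ∈ G
    · have : (⟨j, h⟩ : {i // i ∈ G}) ≠ i := fun h' => hj (congrArg Subtype.val h')
      simp [joinValues, h, hj, this]
    · simp [joinValues, h, hj]

lemma joinBids_update [DecidableEq ι] [DecidableEq {i // i ∈ G}]
    (b : {i // i ∈ G} → ℝ) (bR : {i // i ∉ G} → ℝ) (i : {i // i ∈ G}) (z : ℝ) :
    joinBids G (Function.update b i z) bR = Function.update (joinBids G b bR) i z := by
  funext j
  by_cases hj : j = i
  · subst hj; simp [joinBids]
  · by_cases h : j ∈ G
    · have : (⟨j, h⟩ : {i // i ∈ G}) ≠ i := fun h' => hj (congrArg Subtype.val h')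
      simp [joinBids, h, hj, this]
    · simp [joinBids, h, hj]

lemma joinBids_mem_support {F : ι → Measure ℝ} {b : {i // i ∈ G} → ℝ} {bR : {i // i ∉ G} → ℝ}
    (hb : ∀ i : {i // i ∈ G}, b i ∈ (F i).support) (hbR : ∀ i : {i // i ∉ G}, bR i ∈ (F i).support)
    (i : ι) : joinBids G b bR i ∈ (F i).support := by
  by_cases h : i ∈ G
  · simpa [joinBids, h] using hb ⟨i, h⟩
  · simpa [joinBids, h] using hbR ⟨i, h⟩

lemma myerOPT_pay {κ : Type*} (F : κ → Measure ℝ) (T : (κ → EReal) → Finset κ) (b : κ → ℝ) (i : κ) :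
    (myerOPT F T).pay b i = criticalPayment F {φ | i ∈ T φ} i b := by
  classical
  by_cases h : i ∈ T (virtualValues F b)
  · exact (if_pos h).trans (if_pos h).symm
  · exact (if_neg h).trans (if_neg h).symm

/-- With the red bids fixed, the payment of a green bidder is critical for a region of vectors of
green virtual values, so that Myerson's lemma applies to the full mechanism too. -/
lemma myerOPT_pay_joinBids (F : ι → Measure ℝ) (T : (ι → EReal) → Finset ι)
    (b : {i // i ∈ G} → ℝ) (bR : {i // i ∉ G} → ℝ) (i : {i // i ∈ G}) :
    (myerOPT F T).pay (joinBids G b bR) i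
      = criticalPayment (fun i : {i // i ∈ G} => F i)
          {x | (i : ι) ∈ T (joinValues G x (virtualValues (fun i : {i // i ∉ G} => F i) bR))}
          i b := by
  classical
  rw [myerOPT_pay, criticalPayment, criticalPayment]
  simp only [← joinBids_update, virtualValues_joinBids, mem_ofPred_eq]
  congr!

open Classical in
lemma IsOptimalSelection.isWinningRegion {κ : Type*} {I : Set (Finset κ)}
    {T : (κ → EReal) → Finset κ} (hT : IsOptimalSelection I T) (i : κ) :
    IsWinningRegion {φ | i ∈ T φ} i :=
  ⟨hT.measurable i, fun φ =>
    ⟨fun y hy => by simpa using hT.nonneg _ i hy, fun _ _ hx hxy => hT.mem_update_of_le φ i hx hxy⟩⟩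

open Classical in
lemma IsOptimalSelection.isWinningRegion_join {I : Set (Finset ι)}
    {T : (ι → EReal) → Finset ι} (hT : IsOptimalSelection I T) (y : {i // i ∉ G} → EReal)
    (i : {i // i ∈ G}) : IsWinningRegion {x | (i : ι) ∈ T (joinValues G x y)} i := by
  refine ⟨measurable_joinValues y (hT.measurable i), fun x => ?_⟩
  simp only [mem_ofPred_eq, joinValues_update]
  exact ⟨fun a ha => by simpa using hT.nonneg _ _ ha,
    fun a a' ha haa' => hT.mem_update_of_le _ _ ha haa'⟩

lemma myerOPT_pay_nonneg {κ : Type*} {F : κ → Measure ℝ} (hF : ∀ i, IsValueDistribution (F i))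
    (T : (κ → EReal) → Finset κ) (b : κ → ℝ) (i : κ) : 0 ≤ (myerOPT F T).pay b i := by
  rw [myerOPT_pay]
  exact criticalPayment_nonneg hF _ i b

open Classical in
lemma myerOPT_pay_of_notMem {κ : Type*} {F : κ → Measure ℝ} {T : (κ → EReal) → Finset κ}
    {b : κ → ℝ} {i : κ} (h : i ∉ T (virtualValues F b)) : (myerOPT F T).pay b i = 0 :=
  if_neg h

variable {F : ι → Measure ℝ} [∀ i, IsProbabilityMeasure (F i)]

open Classical in
/-- A winner `s` pays at least the virtual value of each bidder she could be exchanged for: every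
report with which she wins has at least that virtual value, and is itself at least as large. -/
lemma le_myerOPT_pay (hF : ∀ i, IsValueDistribution (F i)) {I : Set (Finset ι)}
    {T : (ι → EReal) → Finset ι} (hT : IsOptimalSelection I T) {b : ι → ℝ}
    (hb : ∀ i, b i ∈ (F i).support) {e s : ι} (he : e ∉ T (virtualValues F b))
    (hs : s ∈ T (virtualValues F b)) (he0 : 0 ≤ virtualValues F b e)
    (hI : insert e ((T (virtualValues F b)).erase s) ∈ I) :
    (virtualValues F b e).toReal ≤ (myerOPT F T).pay b s := by
  have hpay : (myerOPT F T).pay b s = sInf {z : ℝ | z ∈ (F s).support ∧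
      virtualValues F (Function.update b s z) ∈ {φ | s ∈ T φ}} := if_pos hs
  rw [hpay]
  refine le_csInf ⟨b s, hb s, by simpa using hs⟩ ?_
  rintro z ⟨hz, hwin⟩
  have hupd : virtualValues F (Function.update b s z)
      = Function.update (virtualValues F b) s (ironedVirtualValue (F s) z) := by
    funext j
    by_cases hj : j = s
    · subst hj; simp [virtualValues]
    · simp [virtualValues, hj]
  rw [mem_ofPred_eq, hupd] at hwin
  have h0 : 0 ≤ ironedVirtualValue (F s) z := by simpa using hT.nonneg _ s hwin
  refine (hT.le_of_mem_update _ he hs he0 hI hwin).trans ?_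
  have := EReal.toReal_le_toReal ((hF s).ironedVirtualValue_le_self hz h0)
    (fun h => by simp [h] at h0) (EReal.coe_ne_top z)
  rwa [EReal.toReal_coe] at this

lemma virtualSurplus_eq (hF : ∀ i, IsValueDistribution (F i)) {b : ι → ℝ}
    (hb : ∀ i, b i ∈ (F i).support) (Win : Set (ι → EReal)) (i : ι)
    [Decidable (virtualValues F b ∈ Win)] :
    virtualSurplus F Win i b
      = ENNReal.ofReal (if virtualValues F b ∈ Win then (virtualValues F b i).toReal else 0) := by
  rw [virtualSurplus]
  split_ifs with h
  · have hne : virtualValues F b i ≠ ⊤ := (hF i).ironedVirtualValue_ne_top (hb i)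
    rw [indicator_of_mem h, EReal.toENNReal_of_ne_top hne]
  · rw [indicator_of_notMem h, ENNReal.ofReal_zero]

open Classical in
/-- The virtual surplus of the green market is at most that of the green winners of the full market
together with the payments of the red winners. -/
lemma sum_virtualValues_le (hF : ∀ i, IsValueDistribution (F i)) (M : Matroid ι)
    {T : (ι → EReal) → Finset ι} (hT : IsOptimalSelection (matroidMarket M) T)
    {b : ι → ℝ} (hb : ∀ i, b i ∈ (F i).support) {S' : Finset ι} (hS' : M.Indep (S' : Set ι))
    (hS'G : S' ⊆ G) (hS'0 : ∀ i ∈ S', 0 ≤ virtualValues F b i) :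
    ∑ i ∈ S', (virtualValues F b i).toReal
      ≤ ∑ i ∈ T (virtualValues F b),
          if i ∈ G then (virtualValues F b i).toReal else (myerOPT F T).pay b i := by
  refine M.sum_le_sum_of_exchange (hT.feasible _) hS' _ _ ?_ ?_ ?_ ?_
  · intro s hs
    split_ifs
    · exact EReal.toReal_nonneg (hT.nonneg _ s hs)
    · exact myerOPT_pay_nonneg hF T b s
  · intro e he heS hI
    exact hT.le_zero_of_insert _ heS (hS'0 e he) hI
  · intro e he _
    rw [if_pos (hS'G he)]
  · intro e he heS s hs hI
    split_ifs
    · exact hT.le_of_exchange _ heS hs (hS'0 e he) hI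
    · exact le_myerOPT_pay hF hT hb heS hs (hS'0 e he) hI

end Markets

theorem theorem3p2 {ι : Type*} [Fintype ι] (M : Matroid ι)
    -- the specified value distributions of all bidders
    (F : ι → Measure ℝ) [∀ i, IsProbabilityMeasure (F i)]
    (hF_nonneg : ∀ i, F i (Iio 0) = 0)
    (hF_tail : ∀ i, Tendsto (fun z : ℝ => z * (F i).real (Ici z)) atTop (𝓝 0))
    -- the green bidders
    (G : Finset ι)
    -- the selection rules (with their ways of breaking ties) of the mechanism on all bidders and on the green bidders alone
    (T : (ι → EReal) → Finset ι) (hT : IsOptimalSelection (matroidMarket M) T)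
    (T' : ({i // i ∈ G} → EReal) → Finset {i // i ∈ G})
    (hT' : IsOptimalSelection (restrictMarket (matroidMarket M) G) T')
    -- the fixed bids of the red bidders
    (bR : {i // i ∉ G} → ℝ) (hbR : ∀ i : {i // i ∉ G}, bR i ∈ (F i).support) :
    ∫⁻ bG, ENNReal.ofReal ((myerOPT (fun i : {i // i ∈ G} => F i) T').revenue bG)
        ∂(Measure.pi fun i : {i // i ∈ G} => F i) ≤
      ∫⁻ bG, ENNReal.ofReal ((myerOPT F T).revenue (joinBids G bG bR))
        ∂(Measure.pi fun i : {i // i ∈ G} => F i) := by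
  classical
  have hF : ∀ i, IsValueDistribution (F i) := fun i => ⟨hF_nonneg i, hF_tail i⟩
  set FG : {i // i ∈ G} → Measure ℝ := fun i => F i with hFGdef
  have hFG : ∀ i, IsValueDistribution (FG i) := fun i => hF i
  set y : {i // i ∉ G} → EReal := virtualValues (fun i : {i // i ∉ G} => F i) bR with hy
  set Win : {i // i ∈ G} → Set ({i // i ∈ G} → EReal) :=
    fun i => {x | (i : ι) ∈ T (joinValues G x y)} with hWin
  set red : ({i // i ∈ G} → ℝ) → ENNReal := fun b =>
    ∑ r : {i // i ∉ G}, ENNReal.ofReal ((myerOPT F T).pay (joinBids G b bR) r) with hred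
  have hcolours : ∀ {α : Type} [AddCommMonoid α] (c : ι → α),
      ∑ i, c i = ∑ i : {i // i ∈ G}, c i + ∑ r : {i // i ∉ G}, c r := fun c => by
    rw [← Fintype.sum_subtype_add_sum_subtype (· ∈ G) c]
    congr!
  have hgreen := fun i => lintegral_criticalPayment hFG (hT'.isWinningRegion i)
  have hfull := fun i => lintegral_criticalPayment hFG (hT.isWinningRegion_join y i)
  have hL : ∫⁻ b, ENNReal.ofReal ((myerOPT FG T').revenue b) ∂(Measure.pi FG)
      = ∫⁻ b, ∑ i, virtualSurplus FG {x | i ∈ T' x} i b ∂(Measure.pi FG) := by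
    have hsum : ∀ b, ENNReal.ofReal ((myerOPT FG T').revenue b)
        = ∑ i, ENNReal.ofReal (criticalPayment FG {x | i ∈ T' x} i b) := fun b => by
      rw [Mechanism.revenue, ENNReal.ofReal_sum_of_nonneg
        fun i _ => myerOPT_pay_nonneg hFG T' _ i]
      simp only [myerOPT_pay]
    simp only [hsum]
    rw [lintegral_finsetSum' _ fun i _ => (hgreen i).1,
      lintegral_finsetSum' _ fun i _ => (hgreen i).2.1]
    exact Finset.sum_congr rfl fun i _ => (hgreen i).2.2
  have hR : ∫⁻ b, ENNReal.ofReal ((myerOPT F T).revenue (joinBids G b bR)) ∂(Measure.pi FG)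
      = ∫⁻ b, (∑ i, virtualSurplus FG (Win i) i b + red b) ∂(Measure.pi FG) := by
    have hsplit : ∀ b, ENNReal.ofReal ((myerOPT F T).revenue (joinBids G b bR))
        = ∑ i, ENNReal.ofReal (criticalPayment FG (Win i) i b) + red b := fun b => by
      rw [Mechanism.revenue, ENNReal.ofReal_sum_of_nonneg
        fun i _ => myerOPT_pay_nonneg hF T _ i,
        hcolours fun i => ENNReal.ofReal ((myerOPT F T).pay _ i)]
      simp only [myerOPT_pay_joinBids]
      rfl
    simp only [hsplit]
    rw [lintegral_add_left' (Finset.aemeasurable_fun_sum _ fun i _ => (hfull i).1),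
      lintegral_add_left' (Finset.aemeasurable_fun_sum _ fun i _ => (hfull i).2.1),
      lintegral_finsetSum' _ fun i _ => (hfull i).1,
      lintegral_finsetSum' _ fun i _ => (hfull i).2.1]
    congr 1
    exact Finset.sum_congr rfl fun i _ => (hfull i).2.2
  rw [hL, hR]
  refine lintegral_mono_ae ?_
  filter_upwards [ae_mem_support (F := FG)] with b hb
  have hbj : ∀ i, joinBids G b bR i ∈ (F i).support := joinBids_mem_support hb hbR
  have hval : ∀ i : {i // i ∈ G}, virtualValues F (joinBids G b bR) i = virtualValues FG b i :=
    fun i => by simp [virtualValues, joinBids, hFGdef]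
  have hjoin : virtualValues F (joinBids G b bR) = joinValues G (virtualValues FG b) y :=
    virtualValues_joinBids F b bR
  have key := sum_virtualValues_le (G := G) hF M hT hbj
    (S' := (T' (virtualValues FG b)).map (Function.Embedding.subtype fun i => i ∈ G))
    (hT'.feasible _)
    (fun i hi => by
      obtain ⟨j, _, rfl⟩ := Finset.mem_map.1 hi
      exact j.2)
    (fun i hi => by
      obtain ⟨j, hj, rfl⟩ := Finset.mem_map.1 hi
      exact (hT'.nonneg _ j hj).trans_eq (hval j).symm)
  have e1 : ∑ i, virtualSurplus FG {x | i ∈ T' x} i b = ENNReal.ofReal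
      (∑ i ∈ T' (virtualValues FG b), (virtualValues FG b i).toReal) := by
    rw [ENNReal.ofReal_sum_of_nonneg fun i hi => EReal.toReal_nonneg (hT'.nonneg _ i hi)]
    simp only [virtualSurplus_eq hFG hb, mem_ofPred_eq, apply_ite ENNReal.ofReal,
      ENNReal.ofReal_zero, Finset.sum_ite_mem, Finset.univ_inter]
  set S := T (virtualValues F (joinBids G b bR)) with hS
  set c : ι → ℝ := fun i => if i ∈ G then (virtualValues F (joinBids G b bR) i).toReal
    else (myerOPT F T).pay (joinBids G b bR) i with hc
  have hc0 : ∀ i ∈ S, 0 ≤ c i := fun i hi => by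
    simp only [hc]
    split_ifs
    · exact EReal.toReal_nonneg (hT.nonneg _ i hi)
    · exact myerOPT_pay_nonneg hF T _ i
  have e2 : ∑ i, virtualSurplus FG (Win i) i b + red b = ENNReal.ofReal (∑ i ∈ S, c i) := by
    have h1 : ∑ i ∈ S, ENNReal.ofReal (c i)
        = ∑ i, if i ∈ S then ENNReal.ofReal (c i) else 0 := by
      rw [Finset.sum_ite_mem, Finset.univ_inter]
    rw [ENNReal.ofReal_sum_of_nonneg hc0, h1, hcolours]
    congr 1
    · refine Finset.sum_congr rfl fun i _ => ?_
      have hmem : virtualValues FG b ∈ Win i ↔ (i : ι) ∈ S := by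
        rw [hS, hjoin]
        rfl
      simp only [virtualSurplus_eq hFG hb, apply_ite ENNReal.ofReal, ENNReal.ofReal_zero, hmem, hc,
        i.2, if_true, hval]
    · refine Finset.sum_congr rfl fun r _ => ?_
      simp only [hc, r.2, if_false]
      split_ifs with h
      · rfl
      · rw [myerOPT_pay_of_notMem h, ENNReal.ofReal_zero]
  rw [e1, e2]
  refine ENNReal.ofReal_le_ofReal ?_
  rw [Finset.sum_map] at key
  refine le_trans (le_of_eq ?_) key
  exact Finset.sum_congr rfl fun i _ => by
    rw [Function.Embedding.subtype_apply, hval]
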